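/- Let $\mathcal S_+^d$ be the set of symmetric positive semidefinite real $d\times d$ matrices. A set $\mathcal H\subseteq\mathcal S_+^d$ is a *well-structured preconditioner set* if $\mathcal H=\mathcal S_+^d\cap\mathcal K$ for some set $\mathcal K$ of real $d\times d$ matrices that contains the identity $I_d$ and is closed under scalar multiplication, addition and matrix multiplication. For symmetric positive semidefinite $A$ put $$P_{\mathcal H}(A)=\operatorname*{arg\,min}_{H\in\mathcal H}\ \langle A,H^{-1}\rangle+\operatorname{Tr}(H),$$ where $\langle A,B\rangle=\operatorname{Tr}(A^\top B)$ and, for singular $H$, $\langle A,H^{-1}\rangle:=\lim_{\delta\downarrow0}\langle A,(H+\delta I_d)^{-1}\rangle\in[0,\infty]$. Write $\|x\|_H=\sqrt{x^\top Hx}$, and let $\|\cdot\|_{\mathrm{op}}$ be the spectral norm. **Lemma.** There are absolute constants $C_1,C_2>0$ such that the following holds for every dimension $d\ge1$, every well-structured preconditioner set $\mathcal H\subseteq\mathcal S_+^d$, every $\epsilon\ge0$, $\beta\in(0,1]$, $T\in\mathbb N$ and all vectors $g_0,\dots,g_{T-1}\in\mathbb R^d$. Let $M_{-1}=0$ and $M_t=\beta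 M_{t-1}+g_tg_t^\top$ for $0\le t\le T-1$, and let $V_t=P_{\mathcal H}(M_t+\epsilon I_d)$ for $-1\le t\le T-1$. Let $$S_T=\sum_{t=0}^{T-1}V_t^{-1}\left(V_t^2-\beta V_{t-1}^2\right)V_t^{-1},$$ where $V_t^{-1}$ is the inverse of $V_t$ (the Moore–Penrose pseudo-inverse if $V_t$ is singular, which is possible only when $\epsilon=0$). 1. The minimizer that defines $V_t$ exists and is unique for every $-1\le t\le T-1$, and for every positive definite $H\in\mathcal H$, $$\sum_{t=0}^{T-1}\|V_t^{-1}g_t\|_H^2\le\operatorname{Tr}(H)\,\|S_T\|_{\mathrm{op}}.$$ 2. If $\epsilon>0$, then $$\|S_T\|_{\mathrm{op}}\le C_1\left(1+\log\left(1+\frac d\epsilon\sum_{t=0}^{T-1}\|g_t\|_2^2+d^2(1-\beta)T\right)\right)\left(\frac{1-\beta}{\beta}T+\log\left\|V_{T-1}^2/\epsilon\right\|_{\mathrm{op}}\right)+C_2.$$ 3. If $\epsilon>0$ and $\mathcal H$ is commutative (any two of its elements commute), then $$\|S_T\|_{\mathrm{op}}\le(1-\beta)T+\log\left\|V_{T-1}^2/\epsilon\right\|_{\mathrm{op}}.$$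 -/

import Mathlib

open scoped ENNReal

/-- A set `𝓗` of real `d × d` matrices is a well-structured preconditioner set if it consists of
the (symmetric) positive semidefinite matrices lying in some matrix subalgebra that contains the
identity. (A Mathlib `Subalgebra` contains `1` and is closed under sums, products and scalar
multiples; closure under transposition is not required.) -/
def IsWellStructured {d : ℕ} (𝓗 : Set (Matrix (Fin d) (Fin d) ℝ)) : Prop :=
  ∃ K : Subalgebra ℝ (Matrix (Fin d) (Fin d) ℝ), 𝓗 = {A | A.PosSemidef ∧ A ∈ K}

/-- The set `𝓗` is commutative: any two of its elements commute. -/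
def IsCommutativeSet {d : ℕ} (𝓗 : Set (Matrix (Fin d) (Fin d) ℝ)) : Prop :=
  ∀ A ∈ 𝓗, ∀ B ∈ 𝓗, A * B = B * A

/-- The inner product `⟨A, H⁻¹⟩ = Tr(Aᵀ H⁻¹)` for positive semidefinite `A`, `H`, extended to
singular `H` by the limit of `Tr(Aᵀ (H + δ I)⁻¹)` as `δ ↓ 0` (which increases as `δ` decreases, so
the limit is a supremum, possibly `∞`). For positive definite `H` this is the usual value, see
`innerInv_eq_of_posDef`. -/
noncomputable def innerInv {d : ℕ} (A H : Matrix (Fin d) (Fin d) ℝ) : ℝ≥0∞ :=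
  ⨆ δ : {δ : ℝ // 0 < δ},
    ENNReal.ofReal (Matrix.trace (A.transpose * (H + (δ : ℝ) • (1 : Matrix (Fin d) (Fin d) ℝ))⁻¹))

/-- The objective `⟨A, H⁻¹⟩ + Tr(H)`. -/
noncomputable def precondObjective {d : ℕ} (A H : Matrix (Fin d) (Fin d) ℝ) : ℝ≥0∞ :=
  innerInv A H + ENNReal.ofReal (Matrix.trace H)

/-- `V` is a minimizer of `H ↦ ⟨A, H⁻¹⟩ + Tr(H)` over `H ∈ 𝓗`. -/
def IsPrecond {d : ℕ} (𝓗 : Set (Matrix (Fin d) (Fin d) ℝ)) (A V : Matrix (Fin d) (Fin d) ℝ) :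
    Prop :=
  V ∈ 𝓗 ∧ ∀ W ∈ 𝓗, precondObjective A V ≤ precondObjective A W

open Classical in
/-- `P_𝓗(A) = argmin_{H ∈ 𝓗} ⟨A, H⁻¹⟩ + Tr(H)` (the value `0` is used if there is no
minimizer). -/
noncomputable def precond {d : ℕ} (𝓗 : Set (Matrix (Fin d) (Fin d) ℝ))
    (A : Matrix (Fin d) (Fin d) ℝ) : Matrix (Fin d) (Fin d) ℝ :=
  if h : ∃ V, IsPrecond 𝓗 A V then h.choose else 0

/-- The weighted accumulation, with the index shifted by one: `weightedMoment β g t` is `M_{t-1}`,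
where `M_{-1} = 0` and `M_t = β M_{t-1} + g_t g_tᵀ`. -/
noncomputable def weightedMoment {d : ℕ} (β : ℝ) (g : ℕ → EuclideanSpace ℝ (Fin d)) :
    ℕ → Matrix (Fin d) (Fin d) ℝ
  | 0 => 0
  | t + 1 => β • weightedMoment β g t + Matrix.vecMulVec (g t) (g t)

/-- The preconditioners, with the index shifted by one: `precondSeq 𝓗 ε β g t` is
`V_{t-1} = P_𝓗(M_{t-1} + ε I)`. -/
noncomputable def precondSeq {d : ℕ} (𝓗 : Set (Matrix (Fin d) (Fin d) ℝ)) (ε β : ℝ)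
    (g : ℕ → EuclideanSpace ℝ (Fin d)) (t : ℕ) : Matrix (Fin d) (Fin d) ℝ :=
  precond 𝓗 (weightedMoment β g t + ε • (1 : Matrix (Fin d) (Fin d) ℝ))

/-- The inverse of a symmetric matrix, in the sense of the Moore-Penrose pseudo-inverse: nonzero
eigenvalues are inverted and the kernel is kept. For positive definite matrices this is the usual
inverse, see `symInv_eq_of_posDef`. -/
noncomputable def symInv {d : ℕ} (V : Matrix (Fin d) (Fin d) ℝ) : Matrix (Fin d) (Fin d) ℝ :=
  cfc (fun x : ℝ => x⁻¹) V

/-- The (semi-)norm `‖x‖_H = √(xᵀ H x)`. -/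
noncomputable def matNorm {d : ℕ} (H : Matrix (Fin d) (Fin d) ℝ) (x : Fin d → ℝ) : ℝ :=
  Real.sqrt (x ⬝ᵥ H.mulVec x)

/-- The spectral norm: the operator norm with respect to the Euclidean norm. -/
noncomputable def opNorm {d : ℕ} (A : Matrix (Fin d) (Fin d) ℝ) : ℝ :=
  ‖Matrix.toEuclideanCLM (𝕜 := ℝ) A‖

/-- `S_T = ∑_{t=0}^{T-1} V_t⁻¹ (V_t² - β V_{t-1}²) V_t⁻¹`; recall that
`precondSeq 𝓗 ε β g (t + 1)` is `V_t`. -/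
noncomputable def secondOrderSum {d : ℕ} (𝓗 : Set (Matrix (Fin d) (Fin d) ℝ)) (ε β : ℝ)
    (g : ℕ → EuclideanSpace ℝ (Fin d)) (T : ℕ) : Matrix (Fin d) (Fin d) ℝ :=
  ∑ t ∈ Finset.range T,
    symInv (precondSeq 𝓗 ε β g (t + 1)) *
      (precondSeq 𝓗 ε β g (t + 1) ^ 2 - β • precondSeq 𝓗 ε β g t ^ 2) *
      symInv (precondSeq 𝓗 ε β g (t + 1))

theorem symInv_eq_of_posDef {d : ℕ} {V : Matrix (Fin d) (Fin d) ℝ} (hV : V.PosDef) :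
    symInv V = V⁻¹ := by
  have hu : IsUnit V := hV.isUnit
  have h := cfc_inv_id (R := ℝ) hu.unit (hV.isHermitian.isSelfAdjoint)
  rw [IsUnit.unit_spec] at h
  rw [symInv, h, Matrix.coe_units_inv, IsUnit.unit_spec]

open scoped MatrixOrder in
theorem innerInv_eq_of_posDef {d : ℕ} {A H : Matrix (Fin d) (Fin d) ℝ} (hA : A.PosSemidef)
    (hH : H.PosDef) : innerInv A H = ENNReal.ofReal (Matrix.trace (A.transpose * H⁻¹)) := by
  have hAt : A.transpose = A := by simpa using hA.isHermitian.eq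
  have hdet : IsUnit H.det := (Matrix.isUnit_iff_isUnit_det H).1 hH.isUnit
  rw [innerInv, hAt]
  apply le_antisymm
  · refine iSup_le fun ⟨δ, hδ⟩ => ENNReal.ofReal_le_ofReal ?_
    have hP : (H + δ • (1 : Matrix (Fin d) (Fin d) ℝ)).PosDef :=
      hH.add_posSemidef (Matrix.PosSemidef.one.smul hδ.le)
    have hPdet := (Matrix.isUnit_iff_isUnit_det _).1 hP.isUnit
    set B := (H + δ • (1 : Matrix (Fin d) (Fin d) ℝ))⁻¹ with hB
    have e1 : (H + δ • (1 : Matrix (Fin d) (Fin d) ℝ)) * B = 1 := Matrix.mul_nonsing_inv _ hPdet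
    have e2 : B * (H + δ • (1 : Matrix (Fin d) (Fin d) ℝ)) = 1 := Matrix.nonsing_inv_mul _ hPdet
    have e3 : H * H⁻¹ = 1 := Matrix.mul_nonsing_inv _ hdet
    have hBs : B.conjTranspose = B := hP.inv.isHermitian.eq
    have key : H⁻¹ - B =
        B * (δ • (1 : Matrix (Fin d) (Fin d) ℝ) + (δ * δ) • H⁻¹) * B.conjTranspose := by
      have e4 : H⁻¹ - B = δ • (B * H⁻¹) := by
        have h1 : B * (H + δ • (1 : Matrix (Fin d) (Fin d) ℝ)) * H⁻¹ = H⁻¹ := by rw [e2, one_mul]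
        have h2 : B * (H + δ • (1 : Matrix (Fin d) (Fin d) ℝ)) * H⁻¹ = B + δ • (B * H⁻¹) := by
          rw [mul_add, add_mul, mul_assoc, e3]; simp
        rw [h1] at h2
        exact sub_eq_of_eq_add' h2
      have e5 : H⁻¹ * (H + δ • (1 : Matrix (Fin d) (Fin d) ℝ)) = 1 + δ • H⁻¹ := by
        rw [mul_add, Matrix.nonsing_inv_mul _ hdet]; simp
      have e6 : H⁻¹ = (1 + δ • H⁻¹) * B := by rw [← e5, mul_assoc, e1, mul_one]
      rw [e4, hBs]
      conv_lhs => rw [e6]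
      rw [← mul_assoc, ← smul_mul_assoc, ← mul_smul_comm, smul_add, smul_smul]
    have hpsd : (H⁻¹ - B).PosSemidef := by
      rw [key]
      exact ((Matrix.PosSemidef.one.smul hδ.le).add
        (hH.inv.posSemidef.smul (mul_pos hδ hδ).le)).mul_mul_conjTranspose_same B
    have hnn : 0 ≤ Matrix.trace (A * (H⁻¹ - B)) := by
      obtain ⟨C, hC⟩ := CStarAlgebra.nonneg_iff_eq_star_mul_self.1 hpsd.nonneg
      rw [hC, ← mul_assoc, Matrix.trace_mul_comm, ← mul_assoc]
      exact (hA.mul_mul_conjTranspose_same C).trace_nonneg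
    rw [mul_sub, Matrix.trace_sub] at hnn
    linarith
  · have hc : ContinuousAt (fun δ : ℝ => ENNReal.ofReal
        (Matrix.trace (A * (H + δ • (1 : Matrix (Fin d) (Fin d) ℝ))⁻¹))) 0 := by
      refine ENNReal.continuous_ofReal.continuousAt.comp ?_
      have hin : ContinuousAt (fun δ : ℝ => (H + δ • (1 : Matrix (Fin d) (Fin d) ℝ))⁻¹) 0 := by
        have h0 : ContinuousAt (fun B : Matrix (Fin d) (Fin d) ℝ => B⁻¹)
            (H + (0 : ℝ) • (1 : Matrix (Fin d) (Fin d) ℝ)) := by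
          apply continuousAt_matrix_inv
          rw [zero_smul, add_zero]
          have := NormedRing.inverse_continuousAt hdet.unit
          rwa [IsUnit.unit_spec] at this
        exact ContinuousAt.comp (f := fun δ : ℝ => H + δ • (1 : Matrix (Fin d) (Fin d) ℝ)) h0
          (by fun_prop)
      have ht : Continuous (fun B : Matrix (Fin d) (Fin d) ℝ => Matrix.trace (A * B)) := by
        fun_prop
      exact ht.continuousAt.comp hin
    have hlim := (hc.tendsto).mono_left (nhdsWithin_le_nhds (s := Set.Ioi (0 : ℝ)))
    simp only [zero_smul, add_zero] at hlim
    refine le_of_tendsto hlim ?_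
    filter_upwards [self_mem_nhdsWithin] with δ hδ
    exact le_iSup (fun δ : {δ : ℝ // 0 < δ} => ENNReal.ofReal
      (Matrix.trace (A * (H + (δ : ℝ) • (1 : Matrix (Fin d) (Fin d) ℝ))⁻¹))) ⟨δ, hδ⟩

/-! ### Quadratic forms and functional calculus of real symmetric matrices -/

namespace Matrix

/-! Let `K` be the subalgebra. The objective pairs `A` only with symmetric members of `K`, so `A`
may be replaced by its trace-orthogonal projection `E` onto the part of `K` closed under
transposition. `E` is positive semidefinite, and `V = √E` lies in `K`. For `Y = W + δI`, completing
the square gives `tr(V²Y⁻¹) + tr Y = 2 tr V + tr((V - Y)Y⁻¹(V - Y))`; hence `V` is the unique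
minimizer (`exists_isPrecond_iff`).

Since projection is linear, `X_t = V_t² - βV_{t-1}²` is the projection of `g_t g_tᵀ + (1 - β)εI`; it
is positive semidefinite. Pairing `X_t` with `V_t⁻¹HV_t⁻¹ ∈ K` gives part 1 (`sum_matNorm_sq_le`).

For part 2, write `V⁻¹ = (2/π) ∫ R_r dr` with `R_r = (V² + r²)⁻¹`. After truncation to `[α, Γ]`,
Cauchy-Schwarz with respect to `dr/r` bounds the form of `V⁻¹XV⁻¹` by a multiple of `log(Γ/α) ∫ r
R_r X R_r dr`, up to an error governed by `tr X`. Operator convexity of the inverse gives `R_r X_t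
R_r ≤ (βV_{t-1}² + r²)⁻¹ - (V_t² + r²)⁻¹`. Integrated against `r dr`, the sum over `t` telescopes,
at the price of `½ log(1/β)` per step, to a logarithm of `V_{T-1}²/ε` (`sum_integral_resolvent_le`).

In the commutative case `∫₀^∞ 2r R_r D R_r dr = V⁻¹DV⁻¹` exactly, so neither truncation nor
Cauchy-Schwarz is needed and the logarithmic factor disappears
(`sum_dotProduct_inv_conj_le_of_commute`). -/

theorem IsHermitian.transpose_eq {n : Type*} {A : Matrix n n ℝ} (hA : A.IsHermitian) :
    A.transpose = A := by
  simpa using hA.eq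

variable {n : Type*} [Fintype n]

theorem dotProduct_mulVec_self_eq_trace (A : Matrix n n ℝ) (x : n → ℝ) :
    x ⬝ᵥ A *ᵥ x = trace (vecMulVec x x * A) := by
  rw [vecMulVec_mul, trace_vecMulVec, dotProduct_mulVec, dotProduct_comm]

theorem posSemidef_vecMulVec_self (x : n → ℝ) : (vecMulVec x x).PosSemidef := by
  simpa using posSemidef_vecMulVec_self_star x

theorem PosSemidef.of_dotProduct_mulVec {A : Matrix n n ℝ} (hA : A.IsHermitian)
    (h : ∀ x, 0 ≤ x ⬝ᵥ A *ᵥ x) : A.PosSemidef :=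
  .of_dotProduct_mulVec_nonneg hA (by simpa using h)

theorem PosSemidef.dotProduct_mulVec_self_nonneg {A : Matrix n n ℝ} (hA : A.PosSemidef)
    (x : n → ℝ) : 0 ≤ x ⬝ᵥ A *ᵥ x := by
  simpa using hA.dotProduct_mulVec_nonneg x

theorem IsHermitian.mulVec_dotProduct {A : Matrix n n ℝ} (hA : A.IsHermitian) (x y : n → ℝ) :
    A *ᵥ x ⬝ᵥ y = x ⬝ᵥ A *ᵥ y := by
  rw [dotProduct_mulVec, ← mulVec_transpose, hA.transpose_eq]

theorem PosSemidef.conj {A B : Matrix n n ℝ} (hA : A.IsHermitian) (hB : B.PosSemidef) :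
    (A * B * A).PosSemidef := by
  have := hB.mul_mul_conjTranspose_same A
  rwa [hA.eq] at this

variable [DecidableEq n]

theorem continuousOn_spectrum (f : ℝ → ℝ) (V : Matrix n n ℝ) :
    ContinuousOn f (spectrum ℝ V) :=
  V.finite_real_spectrum.continuousOn f

theorem cfc_mul_cfc (f g : ℝ → ℝ) (V : Matrix n n ℝ) :
    cfc f V * cfc g V = cfc (fun x => f x * g x) V :=
  (cfc_mul f g V (continuousOn_spectrum f V) (continuousOn_spectrum g V)).symm

theorem isHermitian_cfc (f : ℝ → ℝ) (V : Matrix n n ℝ) : (cfc f V).IsHermitian :=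
  cfc_predicate (R := ℝ) (p := IsSelfAdjoint) f V

theorem transpose_cfc (f : ℝ → ℝ) (V : Matrix n n ℝ) : (cfc f V).transpose = cfc f V := by
  simpa using (isHermitian_cfc f V).eq

/-- The spectrum is finite, so `f` agrees on it with an interpolating polynomial. This keeps square
roots, pseudo-inverses, resolvents and spectral projections inside `K`, with no closure under
transposition required. -/
theorem cfc_mem_subalgebra (K : Subalgebra ℝ (Matrix n n ℝ)) {V : Matrix n n ℝ}
    (hV : V.IsHermitian) (hK : V ∈ K) (f : ℝ → ℝ) : cfc f V ∈ K := by
  set s := V.finite_real_spectrum.toFinset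
  have h : cfc f V = cfc (Lagrange.interpolate s id f).eval V := by
    refine cfc_congr fun x hx => ?_
    exact (Lagrange.eval_interpolate_at_node f Function.injective_id.injOn
      (V.finite_real_spectrum.mem_toFinset.2 hx)).symm
  rw [h, cfc_polynomial _ _ hV.isSelfAdjoint]
  exact Algebra.adjoin_le (Set.singleton_subset_iff.2 hK)
    (Polynomial.aeval_mem_adjoin_singleton ℝ V)

/-- The quadratic form of a function of a symmetric matrix, in an eigenbasis. -/
theorem dotProduct_cfc_mulVec {V : Matrix n n ℝ} (hV : V.IsHermitian) (f : ℝ → ℝ)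
    (x y : n → ℝ) :
    x ⬝ᵥ cfc f V *ᵥ y = ∑ i, f (hV.eigenvalues i) *
      ((x ⬝ᵥ hV.eigenvectorBasis i) * (hV.eigenvectorBasis i ⬝ᵥ y)) := by
  rw [hV.cfc_eq, IsHermitian.cfc, Unitary.conjStarAlgAut_apply, ← mulVec_mulVec,
    ← mulVec_mulVec, dotProduct_mulVec, dotProduct]
  refine Finset.sum_congr rfl fun i _ => ?_
  rw [mulVec_diagonal]
  have h1 : (x ᵥ* (hV.eigenvectorUnitary : Matrix n n ℝ)) i = x ⬝ᵥ hV.eigenvectorBasis i := by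
    simp [vecMul, dotProduct, IsHermitian.eigenvectorUnitary_apply]
  have h2 : ((star (hV.eigenvectorUnitary : Matrix n n ℝ)) *ᵥ y) i
      = hV.eigenvectorBasis i ⬝ᵥ y := by
    simp [mulVec, dotProduct, IsHermitian.eigenvectorUnitary_apply, star_apply]
  rw [h1, h2]
  simp
  ring

theorem dotProduct_eq_sum_eigenvectorBasis {V : Matrix n n ℝ} (hV : V.IsHermitian)
    (x y : n → ℝ) :
    x ⬝ᵥ y = ∑ i, (x ⬝ᵥ hV.eigenvectorBasis i) * (hV.eigenvectorBasis i ⬝ᵥ y) := by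
  have h := dotProduct_cfc_mulVec hV (fun _ => 1) x y
  rw [cfc_const_one ℝ V hV.isSelfAdjoint, one_mulVec] at h
  simpa using h

theorem dotProduct_mulVec_eq_sum {V : Matrix n n ℝ} (hV : V.IsHermitian) (x y : n → ℝ) :
    x ⬝ᵥ V *ᵥ y = ∑ i, hV.eigenvalues i *
      ((x ⬝ᵥ hV.eigenvectorBasis i) * (hV.eigenvectorBasis i ⬝ᵥ y)) := by
  have h := dotProduct_cfc_mulVec hV (fun x => x) x y
  rwa [cfc_id' ℝ V hV.isSelfAdjoint] at h

theorem eigenvectorBasis_dotProduct_self {V : Matrix n n ℝ} (hV : V.IsHermitian) (i : n) :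
    (hV.eigenvectorBasis i).ofLp ⬝ᵥ (hV.eigenvectorBasis i).ofLp = 1 := by
  have h := hV.eigenvectorBasis.inner_eq_one i
  rw [PiLp.inner_apply] at h
  simpa [dotProduct, sq] using h

theorem eigenvectorBasis_dotProduct_mulVec {V : Matrix n n ℝ} (hV : V.IsHermitian) (i : n) :
    (hV.eigenvectorBasis i).ofLp ⬝ᵥ V *ᵥ (hV.eigenvectorBasis i).ofLp = hV.eigenvalues i := by
  rw [hV.mulVec_eigenvectorBasis, dotProduct_smul, eigenvectorBasis_dotProduct_self]
  simp

theorem eigenvectorBasis_dotProduct_sq_mulVec {V : Matrix n n ℝ} (hV : V.IsHermitian)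
    (i : n) : (hV.eigenvectorBasis i).ofLp ⬝ᵥ V ^ 2 *ᵥ (hV.eigenvectorBasis i).ofLp =
      hV.eigenvalues i ^ 2 := by
  simp only [sq, ← mulVec_mulVec, hV.mulVec_eigenvectorBasis, mulVec_smul, dotProduct_smul,
    eigenvectorBasis_dotProduct_self, smul_eq_mul, mul_one]

theorem PosSemidef.trace_mul_nonneg {A B : Matrix n n ℝ} (hA : A.PosSemidef)
    (hB : B.PosSemidef) : 0 ≤ trace (A * B) := by
  rw [hB.isHermitian.spectral_theorem, Unitary.conjStarAlgAut_apply]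
  set U := (hB.isHermitian.eigenvectorUnitary : Matrix n n ℝ)
  rw [← mul_assoc, trace_mul_comm, ← mul_assoc, ← mul_assoc]
  rw [trace]
  refine Finset.sum_nonneg fun i _ => ?_
  rw [diag_apply, mul_diagonal]
  refine mul_nonneg ?_ (hB.eigenvalues_nonneg i)
  exact (hA.conjTranspose_mul_mul_same U).diag_nonneg

theorem PosSemidef.dotProduct_mulVec_le_trace_mul {A : Matrix n n ℝ} (hA : A.PosSemidef)
    (x : n → ℝ) : x ⬝ᵥ A *ᵥ x ≤ trace A * (x ⬝ᵥ x) := by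
  rw [dotProduct_mulVec_eq_sum hA.isHermitian, dotProduct_eq_sum_eigenvectorBasis hA.isHermitian,
    hA.isHermitian.trace_eq_sum_eigenvalues, Finset.mul_sum]
  refine Finset.sum_le_sum fun i _ => mul_le_mul_of_nonneg_right ?_ ?_
  · exact Finset.single_le_sum (f := fun i => hA.isHermitian.eigenvalues i)
      (fun j _ => hA.eigenvalues_nonneg j) (Finset.mem_univ i)
  · rw [dotProduct_comm x]; exact mul_self_nonneg _

end Matrix

/-! ### The spectral norm and quadratic forms -/

section OperatorNorm

open Matrix

theorem dotProduct_mulVec_le_opNorm {d : ℕ} (A : Matrix (Fin d) (Fin d) ℝ) (x : Fin d → ℝ) :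
    x ⬝ᵥ A *ᵥ x ≤ opNorm A * (x ⬝ᵥ x) := by
  have h1 := real_inner_le_norm (WithLp.toLp 2 x) (toEuclideanCLM (𝕜 := ℝ) A (WithLp.toLp 2 x))
  rw [inner_toEuclideanCLM] at h1
  have h2 := (toEuclideanCLM (𝕜 := ℝ) A).le_opNorm (WithLp.toLp 2 x)
  have h3 : ‖WithLp.toLp 2 x‖ ^ 2 = x ⬝ᵥ x := by
    rw [EuclideanSpace.real_norm_sq_eq]; simp [dotProduct, sq]
  rw [← h3]
  refine h1.trans ?_
  rw [opNorm]
  nlinarith [norm_nonneg (WithLp.toLp 2 x),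
    mul_le_mul_of_nonneg_left h2 (norm_nonneg (WithLp.toLp 2 x))]

/-- Testing on eigenvectors puts the eigenvalues in `[0, c]`, and `‖Ax‖²` is the quadratic form of
`A²`. -/
theorem opNorm_le_of_dotProduct_mulVec_le {d : ℕ} {A : Matrix (Fin d) (Fin d) ℝ}
    (hA : A.PosSemidef) {c : ℝ} (hc : 0 ≤ c) (h : ∀ x, x ⬝ᵥ A *ᵥ x ≤ c * (x ⬝ᵥ x)) :
    opNorm A ≤ c := by
  refine ContinuousLinearMap.opNorm_le_bound _ hc fun x => ?_
  refine le_of_sq_le_sq ?_ (by positivity)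
  rw [mul_pow, EuclideanSpace.real_norm_sq_eq, EuclideanSpace.real_norm_sq_eq]
  have hH := hA.isHermitian
  have e1 : ∑ i, (toEuclideanCLM (𝕜 := ℝ) A x).ofLp i ^ 2
      = x.ofLp ⬝ᵥ cfc (fun t : ℝ => t * t) A *ᵥ x.ofLp := by
    have h2 := cfc_mul_cfc (fun t : ℝ => t) (fun t => t) A
    rw [cfc_id' ℝ A hH.isSelfAdjoint] at h2
    rw [← h2, ← mulVec_mulVec, ← hH.mulVec_dotProduct]
    simp [dotProduct, sq]
  have e2 : ∑ i, x.ofLp i ^ 2 = x.ofLp ⬝ᵥ x.ofLp := by simp [dotProduct, sq]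
  rw [e1, e2, dotProduct_cfc_mulVec hH, dotProduct_eq_sum_eigenvectorBasis hH, Finset.mul_sum]
  refine Finset.sum_le_sum fun i _ => mul_le_mul_of_nonneg_right ?_ ?_
  · have h3 := h (hH.eigenvectorBasis i)
    rw [eigenvectorBasis_dotProduct_mulVec, eigenvectorBasis_dotProduct_self, mul_one] at h3
    rw [sq]
    exact mul_self_le_mul_self (hA.eigenvalues_nonneg i) h3
  · rw [dotProduct_comm x.ofLp]; exact mul_self_nonneg _

theorem trace_mul_le_opNorm {d : ℕ} {A H : Matrix (Fin d) (Fin d) ℝ} (hA : A.IsHermitian)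
    (hH : H.PosSemidef) : trace (A * H) ≤ trace H * opNorm A := by
  have h : (opNorm A • (1 : Matrix (Fin d) (Fin d) ℝ) - A).PosSemidef := by
    refine .of_dotProduct_mulVec ((isHermitian_one.smul (IsSelfAdjoint.all _)).sub hA) fun x => ?_
    rw [sub_mulVec, dotProduct_sub, smul_mulVec, one_mulVec, dotProduct_smul, smul_eq_mul]
    linarith [dotProduct_mulVec_le_opNorm A x]
  have := h.trace_mul_nonneg hH
  rw [sub_mul, trace_sub, smul_mul_assoc, one_mul, trace_smul, smul_eq_mul] at this
  linarith

end OperatorNorm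

/-! ### Positivity and trace duality inside a matrix subalgebra -/

namespace Matrix

variable {n : Type*} [Fintype n] [DecidableEq n]

theorem posSemidef_cfc {V : Matrix n n ℝ} (hV : V.IsHermitian) {f : ℝ → ℝ}
    (hf : ∀ i, 0 ≤ f (hV.eigenvalues i)) : (cfc f V).PosSemidef := by
  refine .of_dotProduct_mulVec (isHermitian_cfc f V) fun x => ?_
  rw [dotProduct_cfc_mulVec hV]
  refine Finset.sum_nonneg fun i _ => mul_nonneg (hf i) ?_
  rw [dotProduct_comm x]
  exact mul_self_nonneg _

theorem cfc_congr_eigenvalues {V : Matrix n n ℝ} (hV : V.IsHermitian) {f g : ℝ → ℝ}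
    (h : ∀ i, f (hV.eigenvalues i) = g (hV.eigenvalues i)) : cfc f V = cfc g V := by
  refine cfc_congr fun x hx => ?_
  rw [hV.spectrum_real_eq_range_eigenvalues] at hx
  obtain ⟨i, rfl⟩ := hx
  exact h i

theorem cfc_eq_one {V : Matrix n n ℝ} (hV : V.IsHermitian) {f : ℝ → ℝ}
    (h : ∀ i, f (hV.eigenvalues i) = 1) : cfc f V = 1 := by
  rw [cfc_congr_eigenvalues hV (g := fun _ => 1) h, cfc_const_one ℝ V hV.isSelfAdjoint]

theorem inv_cfc {V : Matrix n n ℝ} (hV : V.IsHermitian) {f : ℝ → ℝ}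
    (hf : ∀ i, f (hV.eigenvalues i) ≠ 0) : (cfc f V)⁻¹ = cfc (fun x => (f x)⁻¹) V := by
  refine inv_eq_left_inv ?_
  rw [cfc_mul_cfc]
  exact cfc_eq_one hV fun i => inv_mul_cancel₀ (hf i)

theorem cfc_sub_cfc (f g : ℝ → ℝ) (V : Matrix n n ℝ) :
    cfc f V - cfc g V = cfc (fun x => f x - g x) V :=
  (cfc_sub f g V (continuousOn_spectrum f V) (continuousOn_spectrum g V)).symm

theorem cfc_add_smul_one {V : Matrix n n ℝ} (hV : V.IsHermitian) (δ : ℝ) :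
    cfc (fun x => x + δ) V = V + δ • (1 : Matrix n n ℝ) := by
  rw [cfc_add_const δ (fun x => x) V (continuousOn_spectrum _ V) hV.isSelfAdjoint,
    cfc_id' ℝ V hV.isSelfAdjoint, Algebra.algebraMap_eq_smul_one]

theorem PosSemidef.inv_add_smul_one {V : Matrix n n ℝ} (hV : V.PosSemidef) {δ : ℝ}
    (hδ : 0 < δ) : (V + δ • (1 : Matrix n n ℝ))⁻¹ = cfc (fun x => (x + δ)⁻¹) V := by
  rw [← cfc_add_smul_one hV.isHermitian]
  exact inv_cfc hV.isHermitian fun i => (add_pos_of_nonneg_of_pos (hV.eigenvalues_nonneg i) hδ).ne'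

theorem PosSemidef.cfc_sqrt_mul_self {E : Matrix n n ℝ} (hE : E.PosSemidef) :
    cfc Real.sqrt E * cfc Real.sqrt E = E := by
  rw [cfc_mul_cfc]
  conv_rhs => rw [← cfc_id' ℝ E hE.isHermitian.isSelfAdjoint]
  exact cfc_congr_eigenvalues hE.isHermitian fun i => Real.mul_self_sqrt (hE.eigenvalues_nonneg i)

/-- The trace pairing is nondegenerate on the transposition-closed part of `K`: test with `(E -
F)ᵀ`. -/
theorem eq_of_trace_mul_eq {K : Subalgebra ℝ (Matrix n n ℝ)} {E F : Matrix n n ℝ}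
    (hE : E ∈ K) (hE' : E.transpose ∈ K) (hF : F ∈ K) (hF' : F.transpose ∈ K)
    (h : ∀ B ∈ K, B.transpose ∈ K → trace (E * B) = trace (F * B)) : E = F := by
  have h1 := h (E - F).transpose (by rw [transpose_sub]; exact K.sub_mem hE' hF')
    (by rw [transpose_transpose]; exact K.sub_mem hE hF)
  rw [← sub_eq_zero, ← trace_sub, ← sub_mul] at h1
  have h2 : trace ((E - F) * (E - F).conjTranspose) = 0 := by simpa using h1
  exact sub_eq_zero.1 (trace_mul_conjTranspose_self_eq_zero_iff.1 h2)

/-- The trace-preserving projection onto the largest transposition-closed part of a matrix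
subalgebra. -/
theorem exists_mem_trace_mul_eq (K : Subalgebra ℝ (Matrix n n ℝ)) (A : Matrix n n ℝ) :
    ∃ E ∈ K, E.transpose ∈ K ∧
      ∀ B ∈ K, B.transpose ∈ K → trace (E * B) = trace (A * B) := by
  let S : Submodule ℝ (Matrix n n ℝ) :=
    K.toSubmodule ⊓ K.toSubmodule.comap (transposeLinearEquiv n n ℝ ℝ).toLinearMap
  have hS : ∀ B, B ∈ S ↔ B ∈ K ∧ B.transpose ∈ K := fun B => Iff.rfl
  let L : Matrix n n ℝ →ₗ[ℝ] Module.Dual ℝ S :=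
    (LinearMap.lcomp ℝ ℝ S.subtype).comp
      ((LinearMap.llcomp ℝ _ _ _ (traceLinearMap n ℝ ℝ)).comp (LinearMap.mul ℝ (Matrix n n ℝ)))
  have hL : ∀ E (B : S), L E B = trace (E * (B : Matrix n n ℝ)) := fun E B => rfl
  have hinj : Function.Injective (L.comp S.subtype) := by
    intro E F h
    refine Subtype.ext (eq_of_trace_mul_eq ((hS _).1 E.2).1 ((hS _).1 E.2).2 ((hS _).1 F.2).1
      ((hS _).1 F.2).2 fun B hB hB' => ?_)
    exact LinearMap.congr_fun h ⟨B, (hS _).2 ⟨hB, hB'⟩⟩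
  -- In finite dimension a nondegenerate pairing represents every functional, in particular `B ↦
  -- tr(AB)`.
  have hsurj := (LinearMap.injective_iff_surjective_of_finrank_eq_finrank
    (Subspace.dual_finrank_eq (K := ℝ) (V := S)).symm).1 hinj
  obtain ⟨E, hE⟩ := hsurj (L A)
  exact ⟨E, ((hS _).1 E.2).1, ((hS _).1 E.2).2,
    fun B hB hB' => LinearMap.congr_fun hE ⟨B, (hS _).2 ⟨hB, hB'⟩⟩⟩

/-- The spectral projection of `X` onto its negative eigenvalues belongs to `K`. Testing with it
shows that the negative part of `X` has trace zero, hence vanishes. -/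
theorem posSemidef_of_trace_mul_nonneg {K : Subalgebra ℝ (Matrix n n ℝ)} {X : Matrix n n ℝ}
    (hX : X.IsHermitian) (hK : X ∈ K)
    (h : ∀ B ∈ K, B.PosSemidef → 0 ≤ trace (X * B)) : X.PosSemidef := by
  have h1 := h _ (cfc_mem_subalgebra K hX hK (fun x : ℝ => if x < 0 then (1 : ℝ) else 0))
    (posSemidef_cfc hX fun i => by split_ifs <;> norm_num)
  have e1 : X * cfc (fun x : ℝ => if x < 0 then (1 : ℝ) else 0) X =
      -cfc (fun x : ℝ => max (-x) 0) X := by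
    conv_lhs => enter [1]; rw [← cfc_id' ℝ X hX.isSelfAdjoint]
    rw [cfc_mul_cfc, ← cfc_neg]
    refine cfc_congr fun x _ => ?_
    split_ifs with hx
    · rw [max_eq_left (by linarith)]; ring
    · rw [max_eq_right (by linarith)]; ring
  rw [e1, trace_neg] at h1
  have h2 : (cfc (fun x : ℝ => max (-x) 0) X).PosSemidef :=
    posSemidef_cfc hX fun i => le_max_right _ _
  have h3 := h2.trace_eq_zero_iff.1 (le_antisymm (by linarith) h2.trace_nonneg)
  have h4 : X = cfc (fun x : ℝ => x + max (-x) 0) X := by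
    rw [cfc_add (a := X) (fun x : ℝ => x) (fun x => max (-x) 0) (continuousOn_spectrum _ _)
      (continuousOn_spectrum _ _), h3, cfc_id' ℝ X hX.isSelfAdjoint, add_zero]
  rw [h4]
  refine posSemidef_cfc hX fun i => ?_
  have := le_max_left (-hX.eigenvalues i) 0
  linarith

end Matrix

/-! ### Existence and uniqueness of the preconditioner -/

section Minimizer

open Matrix Filter Topology

variable {d : ℕ} {K : Subalgebra ℝ (Matrix (Fin d) (Fin d) ℝ)} {A V W : Matrix (Fin d) (Fin d) ℝ}

/-- Resolvents of `V` are symmetric members of `K`, so `A` can be replaced by `V²`; then `x²/(x + δ)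
≤ x` on the eigenvalues. -/
theorem precondObjective_le (hA : A.PosSemidef) (hV : V.PosSemidef) (hVK : V ∈ K)
    (h : ∀ B ∈ K, B.transpose ∈ K → trace (V ^ 2 * B) = trace (A * B)) :
    precondObjective A V ≤ ENNReal.ofReal (2 * trace V) := by
  rw [precondObjective, two_mul, ENNReal.ofReal_add hV.trace_nonneg hV.trace_nonneg]
  gcongr
  refine iSup_le fun ⟨δ, hδ⟩ => ENNReal.ofReal_le_ofReal ?_
  dsimp only
  have hH := hV.isHermitian
  rw [hA.isHermitian.transpose_eq, hV.inv_add_smul_one hδ,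
    ← h _ (cfc_mem_subalgebra K hH hVK _)
      (by rw [transpose_cfc]; exact cfc_mem_subalgebra K hH hVK _), ← sub_nonneg, ← trace_sub]
  have e : V - V ^ 2 * cfc (fun x => (x + δ)⁻¹) V =
      cfc (fun x => x - x ^ 2 * (x + δ)⁻¹) V := by
    rw [← cfc_sub_cfc, ← cfc_mul_cfc, cfc_pow_id V 2 hH.isSelfAdjoint,
      cfc_id' ℝ V hH.isSelfAdjoint]
  rw [e]
  refine (posSemidef_cfc hH fun i => ?_).trace_nonneg
  have hi := hV.eigenvalues_nonneg i
  have hp : 0 < hH.eigenvalues i + δ := by positivity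
  rw [sub_nonneg, ← div_eq_mul_inv, div_le_iff₀ hp]
  nlinarith

/-- The extra quadratic term is a quantitative gap, and it is what yields uniqueness. It comes from
completing the square at `W + δI` and letting `δ ↓ 0`, which covers singular `W`. -/
theorem le_precondObjective (hA : A.PosSemidef) (hW : W.PosSemidef) (hWK : W ∈ K)
    (h : ∀ B ∈ K, B.transpose ∈ K → trace (V ^ 2 * B) = trace (A * B)) (hV : V.IsHermitian) :
    ENNReal.ofReal (2 * trace V + (trace W + 1)⁻¹ * trace ((V - W) * (V - W))) ≤
      precondObjective A W := by
  have hH := hW.isHermitian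
  have htr := hW.trace_nonneg
  have key : ENNReal.ofReal (2 * trace V - trace W +
      (trace W + 1)⁻¹ * trace ((V - W) * (V - W))) ≤ innerInv A W := by
    have hc : Continuous fun δ : ℝ => ENNReal.ofReal (2 * trace V - trace (W + δ • 1) +
        (trace W + 1)⁻¹ * trace ((V - (W + δ • 1)) * (V - (W + δ • 1)))) := by
      refine ENNReal.continuous_ofReal.comp ?_
      fun_prop
    have hl := (hc.tendsto 0).mono_left (nhdsWithin_le_nhds (s := Set.Ioi (0 : ℝ)))
    simp only [zero_smul, add_zero] at hl
    refine le_of_tendsto hl ?_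
    -- Taking `δ < 1` makes every eigenvalue of `W + δI` at most `tr W + 1`, so the coefficient of
    -- the gap does not depend on `δ`.
    filter_upwards [Ioo_mem_nhdsGT (zero_lt_one (α := ℝ))] with δ hδ
    refine le_trans ?_ (le_iSup (fun δ : {δ : ℝ // 0 < δ} => ENNReal.ofReal
      (trace (A.transpose * (W + (δ : ℝ) • (1 : Matrix (Fin d) (Fin d) ℝ))⁻¹))) ⟨δ, hδ.1⟩)
    refine ENNReal.ofReal_le_ofReal ?_
    dsimp only
    rw [hA.isHermitian.transpose_eq, hW.inv_add_smul_one hδ.1,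
      ← h _ (cfc_mem_subalgebra K hH hWK _)
      (by rw [transpose_cfc]; exact cfc_mem_subalgebra K hH hWK _)]
    set P := cfc (fun x => (x + δ)⁻¹) W with hP
    set Y := W + δ • (1 : Matrix (Fin d) (Fin d) ℝ) with hY
    have hYP : Y * P = 1 := by
      rw [hY, hP, ← cfc_add_smul_one hH, cfc_mul_cfc]
      refine cfc_eq_one hH fun i => mul_inv_cancel₀ ?_
      have := hW.eigenvalues_nonneg i
      linarith [hδ.1]
    have hPY : P * Y = 1 := mul_eq_one_comm.1 hYP
    have hYH : Y.IsHermitian := hH.add (isHermitian_one.smul (IsSelfAdjoint.all _))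
    have hge : (P - (trace W + 1)⁻¹ • (1 : Matrix (Fin d) (Fin d) ℝ)).PosSemidef := by
      have e : P - (trace W + 1)⁻¹ • (1 : Matrix (Fin d) (Fin d) ℝ) =
          cfc (fun x => (x + δ)⁻¹ - (trace W + 1)⁻¹) W := by
        rw [← cfc_sub_cfc, cfc_const _ W hH.isSelfAdjoint, Algebra.algebraMap_eq_smul_one]
      rw [e]
      refine posSemidef_cfc hH fun i => sub_nonneg.2 (inv_anti₀ ?_ ?_)
      · linarith [hW.eigenvalues_nonneg i, hδ.1]
      · have : hH.eigenvalues i ≤ trace W := by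
          rw [hH.trace_eq_sum_eigenvalues]
          exact Finset.single_le_sum (f := fun i => hH.eigenvalues i)
            (fun j _ => hW.eigenvalues_nonneg j) (Finset.mem_univ i)
        linarith [hδ.2]
    have hq := (PosSemidef.conj (hV.sub hYH) hge).trace_nonneg
    have e2 : (V - Y) * (P - (trace W + 1)⁻¹ • 1) * (V - Y) =
        V * P * V - V - V + Y - (trace W + 1)⁻¹ • ((V - Y) * (V - Y)) := by
      have e3 : (V - Y) * P * (V - Y) = V * P * V - V - V + Y := by
        rw [sub_mul, hYP, sub_mul, mul_sub, mul_assoc V P Y, hPY, one_mul, mul_one]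
        abel
      rw [mul_sub (V - Y) P, sub_mul ((V - Y) * P), e3, mul_smul_comm, mul_one, smul_mul_assoc]
    rw [e2, trace_sub, trace_add, trace_sub, trace_sub, trace_mul_cycle, trace_smul, ← sq,
      smul_eq_mul] at hq
    linarith
  calc _ = ENNReal.ofReal ((2 * trace V - trace W +
        (trace W + 1)⁻¹ * trace ((V - W) * (V - W))) + trace W) := by congr 1; ring
    _ ≤ _ := ENNReal.ofReal_add_le
    _ ≤ _ := by rw [precondObjective]; gcongr

/-- The minimizer is the square root of the projection of `A`. -/
theorem exists_isPrecond_iff (hA : A.PosSemidef) :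
    ∃ V, V.PosSemidef ∧ V ∈ K ∧
      (∀ B ∈ K, B.transpose ∈ K → trace (V ^ 2 * B) = trace (A * B)) ∧
      ∀ W, IsPrecond {A | A.PosSemidef ∧ A ∈ K} A W ↔ W = V := by
  obtain ⟨E, hEK, hEK', hE⟩ := exists_mem_trace_mul_eq K A
  -- `A` is symmetric, so `Eᵀ` has the same trace pairings as `E`.
  have hEt : E.transpose = E := by
    refine eq_of_trace_mul_eq hEK' (by simpa using hEK) hEK hEK' fun B hB hB' => ?_
    rw [hE B hB hB', ← trace_transpose, transpose_mul, transpose_transpose, trace_mul_comm,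
      hE _ hB' (by simpa using hB), ← trace_transpose, transpose_mul, transpose_transpose,
      trace_mul_comm, hA.isHermitian.transpose_eq]
  have hEH : E.IsHermitian := by rw [IsHermitian]; simpa using hEt
  have hEP : E.PosSemidef := posSemidef_of_trace_mul_nonneg hEH hEK fun B hB hBp => by
    rw [hE B hB (by rw [hBp.isHermitian.transpose_eq]; exact hB)]
    exact hA.trace_mul_nonneg hBp
  set V := cfc Real.sqrt E with hVdef
  have hV : V.PosSemidef := posSemidef_cfc hEH fun i => Real.sqrt_nonneg _
  have hVK : V ∈ K := cfc_mem_subalgebra K hEH hEK _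
  have hVE : ∀ B ∈ K, B.transpose ∈ K → trace (V ^ 2 * B) = trace (A * B) := by
    rw [sq, hEP.cfc_sqrt_mul_self]; exact hE
  refine ⟨V, hV, hVK, hVE, fun W => ⟨fun hW => ?_, ?_⟩⟩
  -- For a minimizer `W` this chain reads `2 tr V + gap ≤ 2 tr V`, which forces the gap to vanish.
  · have h1 := (le_precondObjective hA hW.1.1 hW.1.2 hVE hV.isHermitian).trans
      ((hW.2 V ⟨hV, hVK⟩).trans (precondObjective_le hA hV hVK hVE))
    have htV := hV.trace_nonneg
    rw [ENNReal.ofReal_le_ofReal_iff (by positivity)] at h1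
    have hpos : 0 < (trace W + 1)⁻¹ := inv_pos.2 (by linarith [hW.1.1.trace_nonneg])
    have hD : (V - W) * (V - W) = (V - W) * (V - W).conjTranspose := by
      rw [(hV.isHermitian.sub hW.1.1.isHermitian).eq]
    have h2 : trace ((V - W) * (V - W)) = 0 := by
      refine le_antisymm ?_ ?_
      · by_contra hc
        have := mul_pos hpos (not_le.1 hc)
        linarith
      · rw [hD]; exact (posSemidef_self_mul_conjTranspose _).trace_nonneg
    rw [hD, trace_mul_conjTranspose_self_eq_zero_iff] at h2
    exact (sub_eq_zero.1 h2).symm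
  · rintro rfl
    refine ⟨⟨hV, hVK⟩, fun W hW => (precondObjective_le hA hV hVK hVE).trans
      (le_trans ?_ (le_precondObjective hA hW.1 hW.2 hVE hV.isHermitian))⟩
    refine ENNReal.ofReal_le_ofReal (le_add_of_nonneg_right (mul_nonneg ?_ ?_))
    · exact inv_nonneg.2 (by linarith [hW.1.trace_nonneg])
    · have hD : (V - W) * (V - W) = (V - W) * (V - W).conjTranspose := by
        rw [(hV.isHermitian.sub hW.1.isHermitian).eq]
      rw [hD]; exact (posSemidef_self_mul_conjTranspose _).trace_nonneg

theorem precond_spec (hA : A.PosSemidef) :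
    (precond {A | A.PosSemidef ∧ A ∈ K} A).PosSemidef ∧ precond {A | A.PosSemidef ∧ A ∈ K} A ∈ K ∧
      (∀ B ∈ K, B.transpose ∈ K →
        trace (precond {A | A.PosSemidef ∧ A ∈ K} A ^ 2 * B) = trace (A * B)) ∧
      ∀ W, IsPrecond {A | A.PosSemidef ∧ A ∈ K} A W ↔
        W = precond {A | A.PosSemidef ∧ A ∈ K} A := by
  obtain ⟨V, h1, h2, h3, h4⟩ := exists_isPrecond_iff (K := K) hA
  have hex : ∃ V, IsPrecond {A | A.PosSemidef ∧ A ∈ K} A V := ⟨V, (h4 V).2 rfl⟩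
  have h5 : precond {A | A.PosSemidef ∧ A ∈ K} A = V := by
    rw [precond, dif_pos hex]
    exact (h4 _).1 hex.choose_spec
  rw [h5]
  exact ⟨h1, h2, h3, h4⟩

end Minimizer

/-! ### Scalar integrals behind the representation of the inverse -/

open Real in
theorem hasDerivAt_half_log_add_sq {a : ℝ} (r : ℝ) (h : 0 < a + r ^ 2) :
    HasDerivAt (fun r => (1 / 2) * log (a + r ^ 2)) (r * (a + r ^ 2)⁻¹) r := by
  have h1 : HasDerivAt (fun r : ℝ => a + r ^ 2) (2 * r) r := by
    simpa using (hasDerivAt_pow 2 r).const_add a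
  exact ((h1.log h.ne').const_mul (1 / 2)).congr_deriv (by ring)

theorem continuous_inv_add_sq {a : ℝ} (ha : 0 < a) : Continuous fun r : ℝ => (a + r ^ 2)⁻¹ :=
  Continuous.inv₀ (by fun_prop) fun r => by positivity

open Real in
theorem integral_mul_inv_add_sq {a : ℝ} (ha : 0 < a) (α Γ : ℝ) :
    ∫ r in α..Γ, r * (a + r ^ 2)⁻¹ =
      (1 / 2) * log (a + Γ ^ 2) - (1 / 2) * log (a + α ^ 2) := by
  refine intervalIntegral.integral_eq_sub_of_hasDerivAt
    (fun r _ => hasDerivAt_half_log_add_sq r (by positivity)) ?_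
  exact (continuous_id.mul (continuous_inv_add_sq ha)).intervalIntegrable _ _

-- The antiderivative `½ log((b + r²)/(a + r²))` is at most `0` at `Γ` and at least `½ log(b/a)` at
-- `α`.
open Real in
theorem integral_mul_inv_sub_inv_le {a b : ℝ} (hb : 0 < b) (hab : b ≤ a) (α Γ : ℝ) :
    ∫ r in α..Γ, r * ((b + r ^ 2)⁻¹ - (a + r ^ 2)⁻¹) ≤ (1 / 2) * log (a / b) := by
  have ha : 0 < a := hb.trans_le hab
  have hi : ∀ {c : ℝ}, 0 < c → IntervalIntegrable (fun r : ℝ => r * (c + r ^ 2)⁻¹)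
      MeasureTheory.volume α Γ := fun hc =>
    (continuous_id.mul (continuous_inv_add_sq hc)).intervalIntegrable _ _
  simp_rw [mul_sub]
  rw [intervalIntegral.integral_sub (hi hb) (hi ha), integral_mul_inv_add_sq hb,
    integral_mul_inv_add_sq ha, log_div ha.ne' hb.ne']
  have h1 : log (b + Γ ^ 2) ≤ log (a + Γ ^ 2) := log_le_log (by positivity) (by linarith)
  have h2 : log (a + α ^ 2) + log b ≤ log (b + α ^ 2) + log a := by
    rw [← log_mul (by positivity) hb.ne', ← log_mul (by positivity) ha.ne']
    refine log_le_log (by positivity) ?_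
    nlinarith [sq_nonneg α]
  linarith

open Real in
theorem arctan_le_of_nonneg {x : ℝ} (hx : 0 ≤ x) : arctan x ≤ x := by
  rcases hx.eq_or_lt with rfl | hx
  · simp
  · have h1 : 0 < arctan x := arctan_pos.2 hx
    have h := lt_tan h1 (arctan_lt_pi_div_two x)
    rw [tan_arctan] at h
    exact h.le

open Real in
/-- The error of truncating the integral representation `x⁻¹ = (2/π) ∫ (x² + r²)⁻¹`. -/
theorem abs_inv_sub_integral_le {l α Γ : ℝ} (hl : 0 < l) (hα : 0 < α) (hΓ : 0 < Γ) :
    |l⁻¹ - (2 / π) * ∫ r in α..Γ, (l ^ 2 + r ^ 2)⁻¹| ≤ Γ⁻¹ + α / l ^ 2 := by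
  rw [integral_inv_sq_add_sq hl.ne']
  have h1 : arctan (Γ / l) = π / 2 - arctan (l / Γ) := by
    rw [← arctan_inv_of_pos (by positivity), inv_div]
  have hk : 2 / π ≤ 1 := (div_le_one pi_pos).2 two_le_pi
  have hk0 : 0 < 2 / π := by positivity
  have e : l⁻¹ - (2 / π) * (l⁻¹ * (arctan (Γ / l) - arctan (α / l))) =
      (2 / π) * (l⁻¹ * (arctan (l / Γ) + arctan (α / l))) := by
    rw [h1]
    have := pi_pos.ne'
    field_simp
    ring
  have h2 : 0 ≤ arctan (l / Γ) := arctan_nonneg.2 (by positivity)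
  have h3 : 0 ≤ arctan (α / l) := arctan_nonneg.2 (by positivity)
  rw [e, abs_of_nonneg (by positivity)]
  calc _ ≤ 1 * (l⁻¹ * (l / Γ + α / l)) := by
        gcongr
        · exact arctan_le_of_nonneg (by positivity)
        · exact arctan_le_of_nonneg (by positivity)
    _ = _ := by field_simp

open Real in
theorem integral_mul_inv_add_sq_sq {a : ℝ} (ha : 0 < a) (Γ : ℝ) :
    ∫ r in (0 : ℝ)..Γ, 2 * r * ((a + r ^ 2)⁻¹ * (a + r ^ 2)⁻¹) = a⁻¹ - (a + Γ ^ 2)⁻¹ := by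
  have hd : ∀ r ∈ Set.uIcc 0 Γ, HasDerivAt (fun r => -(a + r ^ 2)⁻¹)
      (2 * r * ((a + r ^ 2)⁻¹ * (a + r ^ 2)⁻¹)) r := fun r _ => by
    have hp : 0 < a + r ^ 2 := by positivity
    have h1 : HasDerivAt (fun r : ℝ => a + r ^ 2) (2 * r) r := by
      simpa using (hasDerivAt_pow 2 r).const_add a
    exact (h1.fun_inv hp.ne').fun_neg.congr_deriv (by field_simp)
  have hc := continuous_inv_add_sq ha
  rw [intervalIntegral.integral_eq_sub_of_hasDerivAt hd
    (Continuous.intervalIntegrable (by fun_prop) _ _)]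
  simp only [ne_eq, OfNat.ofNat_ne_zero, not_false_eq_true, zero_pow, add_zero]
  ring

/-! ### Resolvent inequalities and their integrals -/

namespace Matrix

variable {n : Type*} [Fintype n] {V W X : Matrix n n ℝ} {φ : ℝ → ℝ}

theorem PosSemidef.two_mul_dotProduct_mulVec_le (hX : X.PosSemidef) (x y : n → ℝ) {k : ℝ}
    (hk : 0 < k) : 2 * (x ⬝ᵥ X *ᵥ y) ≤ k * (x ⬝ᵥ X *ᵥ x) + k⁻¹ * (y ⬝ᵥ X *ᵥ y) := by
  have h := hX.dotProduct_mulVec_self_nonneg (k • x - y)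
  have hs : y ⬝ᵥ X *ᵥ x = x ⬝ᵥ X *ᵥ y := by
    rw [← hX.isHermitian.mulVec_dotProduct, dotProduct_comm]
  rw [mulVec_sub, mulVec_smul, dotProduct_sub, sub_dotProduct, sub_dotProduct, smul_dotProduct,
    smul_dotProduct, dotProduct_smul, dotProduct_smul, hs] at h
  simp only [smul_eq_mul] at h
  have h2 := mul_nonneg (inv_nonneg.2 hk.le) h
  have e : k⁻¹ * (k * (k * x ⬝ᵥ X *ᵥ x) - k * x ⬝ᵥ X *ᵥ y - (k * x ⬝ᵥ X *ᵥ y - y ⬝ᵥ X *ᵥ y)) =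
      k * (x ⬝ᵥ X *ᵥ x) - 2 * (x ⬝ᵥ X *ᵥ y) + k⁻¹ * (y ⬝ᵥ X *ᵥ y) := by
    field_simp
    ring
  linarith

variable [DecidableEq n]

theorem continuous_dotProduct_cfc_inv_add_sq (hV : V.IsHermitian)
    (hφ : ∀ i, 0 < φ (hV.eigenvalues i)) (x y : n → ℝ) :
    Continuous fun r : ℝ => x ⬝ᵥ cfc (fun t => (φ t + r ^ 2)⁻¹) V *ᵥ y := by
  simp_rw [dotProduct_cfc_mulVec hV]
  exact continuous_finsetSum _ fun i _ => (continuous_inv_add_sq (hφ i)).mul continuous_const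

theorem continuous_cfc_inv_add_sq_mulVec (hV : V.IsHermitian)
    (hφ : ∀ i, 0 < φ (hV.eigenvalues i)) (y : n → ℝ) :
    Continuous fun r : ℝ => cfc (fun t => (φ t + r ^ 2)⁻¹) V *ᵥ y := by
  refine continuous_pi fun i => ?_
  have := continuous_dotProduct_cfc_inv_add_sq hV hφ (Pi.single i 1) y
  simpa using this

/-- Both resolvents are functions of the same `V`, so the scalar logarithmic bound applies to each
eigenvector. It serves with `φ t = β t²` for the loss in one step and with constant `φ = ε` for the
endpoints of the telescope. -/
theorem integral_resolvent_sub_le (hV : V.IsHermitian) (hφ : ∀ i, 0 < φ (hV.eigenvalues i))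
    (hφV : ∀ i, φ (hV.eigenvalues i) ≤ hV.eigenvalues i ^ 2) {L : ℝ}
    (hL : ∀ i, Real.log (hV.eigenvalues i ^ 2 / φ (hV.eigenvalues i)) ≤ L) (v : n → ℝ)
    (α Γ : ℝ) :
    ∫ r in α..Γ, r * (v ⬝ᵥ cfc (fun t => (φ t + r ^ 2)⁻¹) V *ᵥ v -
        v ⬝ᵥ cfc (fun t => (t ^ 2 + r ^ 2)⁻¹) V *ᵥ v) ≤ (1 / 2) * L * (v ⬝ᵥ v) := by
  have hp : ∀ i, 0 < hV.eigenvalues i ^ 2 := fun i => (hφ i).trans_le (hφV i)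
  have e : ∀ r : ℝ, r * (v ⬝ᵥ cfc (fun t => (φ t + r ^ 2)⁻¹) V *ᵥ v -
        v ⬝ᵥ cfc (fun t => (t ^ 2 + r ^ 2)⁻¹) V *ᵥ v) =
      ∑ i, (r * ((φ (hV.eigenvalues i) + r ^ 2)⁻¹ - (hV.eigenvalues i ^ 2 + r ^ 2)⁻¹)) *
        ((v ⬝ᵥ hV.eigenvectorBasis i) * (hV.eigenvectorBasis i ⬝ᵥ v)) := fun r => by
    rw [dotProduct_cfc_mulVec hV, dotProduct_cfc_mulVec hV, ← Finset.sum_sub_distrib,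
      Finset.mul_sum]
    exact Finset.sum_congr rfl fun i _ => by ring
  simp_rw [e]
  rw [intervalIntegral.integral_finsetSum, dotProduct_eq_sum_eigenvectorBasis hV v v,
    Finset.mul_sum]
  · refine Finset.sum_le_sum fun i _ => ?_
    rw [intervalIntegral.integral_mul_const]
    refine mul_le_mul_of_nonneg_right ?_ ?_
    · exact (integral_mul_inv_sub_inv_le (hφ i) (hφV i) α Γ).trans (by linarith [hL i])
    · rw [dotProduct_comm v]; exact mul_self_nonneg _
  · intro i _
    have h1 := continuous_inv_add_sq (hφ i)
    have h2 := continuous_inv_add_sq (hp i)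
    exact Continuous.intervalIntegrable (by fun_prop) _ _

theorem cfc_mul_sq_add_sq (hV : V.IsHermitian) (b r : ℝ) :
    cfc (fun t => b * t ^ 2 + r ^ 2) V = b • V ^ 2 + r ^ 2 • (1 : Matrix n n ℝ) := by
  rw [cfc_add_const (r ^ 2) (fun t => b * t ^ 2) V (continuousOn_spectrum _ V) hV.isSelfAdjoint,
    cfc_const_mul b (fun t => t ^ 2) V (continuousOn_spectrum _ V), cfc_pow_id V 2 hV.isSelfAdjoint,
    Algebra.algebraMap_eq_smul_one]

theorem cfc_inv_mul_cfc (hV : V.IsHermitian) {f : ℝ → ℝ} (hf : ∀ i, f (hV.eigenvalues i) ≠ 0) :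
    cfc (fun t => (f t)⁻¹) V * cfc f V = 1 := by
  rw [cfc_mul_cfc]
  exact cfc_eq_one hV fun i => inv_mul_cancel₀ (hf i)

/-- Convexity of the inverse, `A⁻¹ (A - B) A⁻¹ ≤ B⁻¹ - A⁻¹`, for shifted squares. -/
theorem resolvent_mul_sub_mul_resolvent_le (hV : V.PosDef) (hW : W.PosDef) {b : ℝ} (hb : 0 < b)
    (r : ℝ) (v : n → ℝ) :
    cfc (fun t => (t ^ 2 + r ^ 2)⁻¹) V *ᵥ v ⬝ᵥ
        (V ^ 2 - b • W ^ 2) *ᵥ (cfc (fun t => (t ^ 2 + r ^ 2)⁻¹) V *ᵥ v) ≤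
      v ⬝ᵥ cfc (fun t => (b * t ^ 2 + r ^ 2)⁻¹) W *ᵥ v -
        v ⬝ᵥ cfc (fun t => (t ^ 2 + r ^ 2)⁻¹) V *ᵥ v := by
  have hVH := hV.isHermitian
  have hWH := hW.isHermitian
  have hpV : ∀ i, 0 < hVH.eigenvalues i ^ 2 + r ^ 2 := fun i => by
    have := hV.eigenvalues_pos i; positivity
  have hpW : ∀ i, 0 < b * hWH.eigenvalues i ^ 2 + r ^ 2 := fun i => by
    have := hW.eigenvalues_pos i; positivity
  set P := cfc (fun t => (t ^ 2 + r ^ 2)⁻¹) V with hP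
  set Q := cfc (fun t => (b * t ^ 2 + r ^ 2)⁻¹) W with hQ
  set N := cfc (fun t => b * t ^ 2 + r ^ 2) W with hN
  set M := cfc (fun t => t ^ 2 + r ^ 2) V with hM
  have hPH : P.IsHermitian := isHermitian_cfc _ _
  have hQH : Q.IsHermitian := isHermitian_cfc _ _
  have hNP : N.PosSemidef := posSemidef_cfc hWH fun i => (hpW i).le
  have hPM : P * M = 1 := cfc_inv_mul_cfc hVH fun i => (hpV i).ne'
  have hQN : Q * N = 1 := cfc_inv_mul_cfc hWH fun i => (hpW i).ne'
  have hNQ : N * Q = 1 := mul_eq_one_comm.1 hQN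
  have hMN : V ^ 2 - b • W ^ 2 = M - N := by
    have h1 := cfc_mul_sq_add_sq hVH 1 r
    simp only [one_mul, one_smul] at h1
    rw [hM, hN, h1, cfc_mul_sq_add_sq hWH]
    abel
  -- The difference of the two sides is the quadratic form of `(Q - P)N(Q - P)`, where `P = M⁻¹` and
  -- `Q = N⁻¹`.
  have h := (PosSemidef.conj (hQH.sub hPH) hNP).dotProduct_mulVec_self_nonneg v
  have e : (Q - P) * N * (Q - P) = Q - P - P * (V ^ 2 - b • W ^ 2) * P := by
    rw [hMN, mul_sub P, hPM, sub_mul 1, one_mul, sub_mul Q, hQN, sub_mul, one_mul, mul_sub (P * N),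
      mul_assoc P N Q, hNQ, mul_one]
  rw [e, sub_mulVec, dotProduct_sub, sub_mulVec, dotProduct_sub, ← mulVec_mulVec,
    ← mulVec_mulVec] at h
  rw [hPH.mulVec_dotProduct]
  linarith

theorem integral_dotProduct_resolvent (hV : V.PosDef) (x y : n → ℝ) (α Γ : ℝ) :
    ∫ r in α..Γ, x ⬝ᵥ cfc (fun t => (t ^ 2 + r ^ 2)⁻¹) V *ᵥ y =
      x ⬝ᵥ cfc (fun t => ∫ r in α..Γ, (t ^ 2 + r ^ 2)⁻¹) V *ᵥ y := by
  simp_rw [dotProduct_cfc_mulVec hV.isHermitian]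
  rw [intervalIntegral.integral_finsetSum]
  · exact Finset.sum_congr rfl fun i _ => intervalIntegral.integral_mul_const _ _
  · intro i _
    have := continuous_inv_add_sq (pow_pos (hV.eigenvalues_pos i) 2)
    exact Continuous.intervalIntegrable (by fun_prop) _ _

-- Cauchy-Schwarz for the form `X` with respect to `dr/r`: the mass of `[α, Γ]` is `log(Γ/α)`, and
-- the remaining factor carries the weight `r`.
open Real in
theorem dotProduct_integral_resolvent_le (hV : V.PosDef) (hX : X.PosSemidef) (v : n → ℝ)
    {α Γ : ℝ} (hα : 0 < α) (hΓ : α < Γ) :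
    cfc (fun t => (2 / π) * ∫ r in α..Γ, (t ^ 2 + r ^ 2)⁻¹) V *ᵥ v ⬝ᵥ
        X *ᵥ (cfc (fun t => (2 / π) * ∫ r in α..Γ, (t ^ 2 + r ^ 2)⁻¹) V *ᵥ v) ≤
      (4 / π ^ 2) * log (Γ / α) *
        ∫ r in α..Γ, r * (cfc (fun t => (t ^ 2 + r ^ 2)⁻¹) V *ᵥ v ⬝ᵥ
          X *ᵥ (cfc (fun t => (t ^ 2 + r ^ 2)⁻¹) V *ᵥ v)) := by
  have hVH := hV.isHermitian
  set p := cfc (fun t => (2 / π) * ∫ r in α..Γ, (t ^ 2 + r ^ 2)⁻¹) V *ᵥ v with hp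
  set J := ∫ r in α..Γ, r * (cfc (fun t => (t ^ 2 + r ^ 2)⁻¹) V *ᵥ v ⬝ᵥ
          X *ᵥ (cfc (fun t => (t ^ 2 + r ^ 2)⁻¹) V *ᵥ v)) with hJ
  set P := p ⬝ᵥ X *ᵥ p with hP
  set ℓ := log (Γ / α) with hℓ
  have hℓ0 : 0 < ℓ := log_pos ((one_lt_div hα).2 hΓ)
  have hpi := pi_pos
  have hcv := continuous_cfc_inv_add_sq_mulVec (φ := fun t => t ^ 2) hVH
    (fun i => pow_pos (hV.eigenvalues_pos i) 2) v
  have e1 : P = (2 / π) * ∫ r in α..Γ, cfc (fun t => (t ^ 2 + r ^ 2)⁻¹) V *ᵥ v ⬝ᵥ X *ᵥ p := by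
    have e2 : ∀ r : ℝ, cfc (fun t => (t ^ 2 + r ^ 2)⁻¹) V *ᵥ v ⬝ᵥ X *ᵥ p =
        (X *ᵥ p) ⬝ᵥ cfc (fun t => (t ^ 2 + r ^ 2)⁻¹) V *ᵥ v := fun r => dotProduct_comm _ _
    simp_rw [e2]
    rw [integral_dotProduct_resolvent hV, hP, dotProduct_comm p, ← smul_eq_mul (2 / π),
      ← dotProduct_smul, ← smul_mulVec]
    conv_lhs => enter [2]; rw [hp]
    rw [cfc_const_mul _ _ V (continuousOn_spectrum _ V)]
  have hne : ∀ r ∈ Set.uIcc α Γ, r ≠ 0 := fun r hr => by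
    rw [Set.uIcc_of_le hΓ.le] at hr
    exact (hα.trans_le hr.1).ne'
  -- This value makes the `P` term on the right exactly `P / 2`, which is then absorbed into the
  -- left side.
  set c := (2 / π) * ℓ with hc
  have hc0 : 0 < c := by positivity
  have h1 : ∫ r in α..Γ, cfc (fun t => (t ^ 2 + r ^ 2)⁻¹) V *ᵥ v ⬝ᵥ X *ᵥ p ≤
      ∫ r in α..Γ, ((c / 2) * (r * (cfc (fun t => (t ^ 2 + r ^ 2)⁻¹) V *ᵥ v ⬝ᵥ
          X *ᵥ (cfc (fun t => (t ^ 2 + r ^ 2)⁻¹) V *ᵥ v))) + (c⁻¹ / 2 * P) * r⁻¹) := by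
    refine intervalIntegral.integral_mono_on hΓ.le ?_ ?_ fun r hr => ?_
    · exact Continuous.intervalIntegrable (by fun_prop) _ _
    · refine IntervalIntegrable.add ?_ ?_
      · exact Continuous.intervalIntegrable (by fun_prop) _ _
      · exact (intervalIntegral.intervalIntegrable_inv hne continuousOn_id).const_mul _
    · have hr0 : 0 < r := hα.trans_le hr.1
      have := hX.two_mul_dotProduct_mulVec_le (cfc (fun t => (t ^ 2 + r ^ 2)⁻¹) V *ᵥ v) p
        (mul_pos hc0 hr0)
      rw [mul_inv, ← hP] at this
      linarith
  rw [intervalIntegral.integral_add, intervalIntegral.integral_const_mul,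
    intervalIntegral.integral_const_mul, integral_inv_of_pos hα (hα.trans hΓ), ← hJ, ← hℓ] at h1
  · have h2 : P ≤ (2 / π) * (c / 2 * J + c⁻¹ / 2 * P * ℓ) := by
      rw [e1]
      conv_rhs => rw [← e1]
      gcongr
    have e3 : (2 / π) * (c / 2 * J + c⁻¹ / 2 * P * ℓ) = (2 / π ^ 2) * ℓ * J + P / 2 := by
      rw [hc]
      field_simp
    have e4 : (4 / π ^ 2) * ℓ * J = 2 * ((2 / π ^ 2) * ℓ * J) := by ring
    linarith
  · exact Continuous.intervalIntegrable (by fun_prop) _ _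
  · exact (intervalIntegral.intervalIntegrable_inv hne continuousOn_id).const_mul _

end Matrix

/-! ### Summed bounds for abstract sequences of positive definite matrices -/

namespace Matrix

variable {n : Type*} [Fintype n] [DecidableEq n]

-- Split `V⁻¹v = p + e` into the truncated integral over `[s/k, sk]` and its error. With eigenvalues
-- at least `s`, both tails contribute at most `1/(sk)` to the error.
open Real in
theorem dotProduct_inv_conj_le {V X : Matrix n n ℝ} (hV : V.PosDef) (hX : X.PosSemidef)
    {s k : ℝ} (hs : 0 < s) (hk : 1 < k)
    (hlow : ∀ i, s ^ 2 ≤ hV.isHermitian.eigenvalues i ^ 2) (v : n → ℝ) :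
    v ⬝ᵥ (cfc (fun x : ℝ => x⁻¹) V * X * cfc (fun x : ℝ => x⁻¹) V) *ᵥ v ≤
      log (k ^ 2) * (∫ r in (s / k)..(s * k), r * (cfc (fun t => (t ^ 2 + r ^ 2)⁻¹) V *ᵥ v ⬝ᵥ
          X *ᵥ (cfc (fun t => (t ^ 2 + r ^ 2)⁻¹) V *ᵥ v))) +
        8 / (s ^ 2 * k ^ 2) * trace X * (v ⬝ᵥ v) := by
  have hH := hV.isHermitian
  have hk0 : 0 < k := by linarith
  have hα : 0 < s / k := by positivity
  have hαΓ : s / k < s * k := by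
    rw [div_lt_iff₀ hk0]
    nlinarith [mul_lt_mul_of_pos_left hk hs, mul_pos hs hk0]
  have hP := dotProduct_integral_resolvent_le hV hX v hα hαΓ
  have hquot : s * k / (s / k) = k ^ 2 := by field_simp
  rw [hquot] at hP
  set J := ∫ r in (s / k)..(s * k), r * (cfc (fun t => (t ^ 2 + r ^ 2)⁻¹) V *ᵥ v ⬝ᵥ
          X *ᵥ (cfc (fun t => (t ^ 2 + r ^ 2)⁻¹) V *ᵥ v)) with hJ
  have hJ0 : 0 ≤ J := intervalIntegral.integral_nonneg hαΓ.le fun r hr =>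
    mul_nonneg (hα.le.trans hr.1) (hX.dotProduct_mulVec_self_nonneg _)
  set f := fun t : ℝ => (2 / π) * ∫ r in (s / k)..(s * k), (t ^ 2 + r ^ 2)⁻¹ with hf
  set p := cfc f V *ᵥ v with hp
  set e := cfc (fun t => t⁻¹ - f t) V *ᵥ v with he
  have hu : cfc (fun x : ℝ => x⁻¹) V *ᵥ v = p + e := by
    rw [hp, he, ← cfc_sub_cfc, sub_mulVec]
    abel
  have hlog : 0 ≤ log (k ^ 2) := log_nonneg (by nlinarith)
  have hee : e ⬝ᵥ e ≤ 4 / (s ^ 2 * k ^ 2) * (v ⬝ᵥ v) := by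
    rw [he, (isHermitian_cfc _ V).mulVec_dotProduct, mulVec_mulVec, cfc_mul_cfc,
      dotProduct_cfc_mulVec hH, dotProduct_eq_sum_eigenvectorBasis hH, Finset.mul_sum]
    refine Finset.sum_le_sum fun i _ => mul_le_mul_of_nonneg_right ?_ ?_
    · have hl := hV.eigenvalues_pos i
      have h1 := abs_inv_sub_integral_le (l := hH.eigenvalues i) hl hα (hα.trans hαΓ)
      have h2 : (s * k)⁻¹ + s / k / hH.eigenvalues i ^ 2 ≤ 2 / (s * k) := by
        have h3 : s / k / hH.eigenvalues i ^ 2 ≤ s / k / s ^ 2 := by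
          exact div_le_div_of_nonneg_left hα.le (by positivity) (hlow i)
        have h4 : s / k / s ^ 2 = (s * k)⁻¹ := by field_simp
        have h5 : 2 / (s * k) = (s * k)⁻¹ + (s * k)⁻¹ := by ring
        linarith
      have h6 := abs_le_abs_of_nonneg (abs_nonneg _) (h1.trans h2)
      rw [abs_abs] at h6
      have h7 := sq_le_sq.2 h6
      have h8 : (2 / (s * k)) ^ 2 = 4 / (s ^ 2 * k ^ 2) := by ring
      rw [h8, sq] at h7
      exact h7
    · rw [dotProduct_comm v]; exact mul_self_nonneg _
  have heX : e ⬝ᵥ X *ᵥ e ≤ 4 / (s ^ 2 * k ^ 2) * trace X * (v ⬝ᵥ v) := by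
    refine (hX.dotProduct_mulVec_le_trace_mul e).trans ?_
    refine (mul_le_mul_of_nonneg_left hee hX.trace_nonneg).trans_eq (by ring)
  have hs2 : e ⬝ᵥ X *ᵥ p = p ⬝ᵥ X *ᵥ e := by
    rw [← hX.isHermitian.mulVec_dotProduct, dotProduct_comm]
  have hsplit : (p + e) ⬝ᵥ X *ᵥ (p + e) ≤ 2 * (p ⬝ᵥ X *ᵥ p) + 2 * (e ⬝ᵥ X *ᵥ e) := by
    have := hX.two_mul_dotProduct_mulVec_le p e one_pos
    rw [mulVec_add, add_dotProduct, dotProduct_add, dotProduct_add, hs2]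
    rw [inv_one, one_mul, one_mul] at this
    linarith
  -- Since `4/π² ≤ 1/2`, the factor `2` lost in splitting `p + e` is recovered.
  have hpi : (4 / π ^ 2) * log (k ^ 2) * J ≤ (1 / 2) * (log (k ^ 2) * J) := by
    rw [mul_assoc]
    refine mul_le_mul_of_nonneg_right ?_ (mul_nonneg hlog hJ0)
    rw [div_le_div_iff₀ (by positivity) (by norm_num)]
    nlinarith [pi_gt_three]
  have hfin : v ⬝ᵥ (cfc (fun x : ℝ => x⁻¹) V * X * cfc (fun x : ℝ => x⁻¹) V) *ᵥ v =
      (p + e) ⬝ᵥ X *ᵥ (p + e) := by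
    rw [← hu, ← mulVec_mulVec, ← mulVec_mulVec, (isHermitian_cfc _ V).mulVec_dotProduct]
  rw [hfin]
  have h8 : 8 / (s ^ 2 * k ^ 2) * trace X * (v ⬝ᵥ v) =
    2 * (4 / (s ^ 2 * k ^ 2) * trace X * (v ⬝ᵥ v)) := by ring
  linarith

/-- With `F t` and `G t` the integrals for `V t ^ 2` and `β • V t ^ 2`, each term is at most `G t -
F (t + 1)`. Here `G t - F t` costs `½ log(1/β)`, and `F t - F (t + 1)` telescopes. No positivity of
the increments is needed, which the commutative case exploits. -/
theorem sum_integral_resolvent_le {V : ℕ → Matrix n n ℝ} (hV : ∀ t, (V t).PosDef) {ε β L : ℝ}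
    (hε : 0 < ε) (hβ : 0 < β) (hβ1 : β ≤ 1) (h0 : V 0 ^ 2 = ε • (1 : Matrix n n ℝ)) (T : ℕ)
    (hlow : ∀ i, ε ≤ (hV T).isHermitian.eigenvalues i ^ 2)
    (hL : ∀ i, Real.log ((hV T).isHermitian.eigenvalues i ^ 2 / ε) ≤ L) (v : n → ℝ) {α Γ : ℝ}
    (hα : 0 ≤ α) (hΓ : α ≤ Γ) :
    ∑ t ∈ Finset.range T, ∫ r in α..Γ, r *
        (cfc (fun t => (t ^ 2 + r ^ 2)⁻¹) (V (t + 1)) *ᵥ v ⬝ᵥ (V (t + 1) ^ 2 - β • V t ^ 2) *ᵥ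
          (cfc (fun t => (t ^ 2 + r ^ 2)⁻¹) (V (t + 1)) *ᵥ v)) ≤
      (1 / 2) * (T * Real.log (1 / β) + L) * (v ⬝ᵥ v) := by
  set F : ℕ → ℝ := fun t => ∫ r in α..Γ, r * (v ⬝ᵥ cfc (fun t => (t ^ 2 + r ^ 2)⁻¹) (V t) *ᵥ v)
    with hF
  set G : ℕ → ℝ := fun t =>
    ∫ r in α..Γ, r * (v ⬝ᵥ cfc (fun t => (β * t ^ 2 + r ^ 2)⁻¹) (V t) *ᵥ v) with hG
  have hcF : ∀ t, Continuous fun r : ℝ =>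
      v ⬝ᵥ cfc (fun t => (t ^ 2 + r ^ 2)⁻¹) (V t) *ᵥ v := fun t =>
    continuous_dotProduct_cfc_inv_add_sq (φ := fun t => t ^ 2) (hV t).isHermitian
      (fun i => pow_pos ((hV t).eigenvalues_pos i) 2) v v
  have hcG : ∀ t, Continuous fun r : ℝ =>
      v ⬝ᵥ cfc (fun t => (β * t ^ 2 + r ^ 2)⁻¹) (V t) *ᵥ v := fun t =>
    continuous_dotProduct_cfc_inv_add_sq (φ := fun t => β * t ^ 2) (hV t).isHermitian
      (fun i => mul_pos hβ (pow_pos ((hV t).eigenvalues_pos i) 2)) v v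
  have hiF : ∀ t, IntervalIntegrable (fun r : ℝ => r * (v ⬝ᵥ
      cfc (fun t => (t ^ 2 + r ^ 2)⁻¹) (V t) *ᵥ v)) MeasureTheory.volume α Γ := fun t =>
    (continuous_id.mul (hcF t)).intervalIntegrable _ _
  have hiG : ∀ t, IntervalIntegrable (fun r : ℝ => r * (v ⬝ᵥ
      cfc (fun t => (β * t ^ 2 + r ^ 2)⁻¹) (V t) *ᵥ v)) MeasureTheory.volume α Γ := fun t =>
    (continuous_id.mul (hcG t)).intervalIntegrable _ _
  have h1 : ∀ t, ∫ r in α..Γ, r *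
        (cfc (fun t => (t ^ 2 + r ^ 2)⁻¹) (V (t + 1)) *ᵥ v ⬝ᵥ (V (t + 1) ^ 2 - β • V t ^ 2) *ᵥ
          (cfc (fun t => (t ^ 2 + r ^ 2)⁻¹) (V (t + 1)) *ᵥ v)) ≤ G t - F (t + 1) := fun t => by
    rw [hF, hG, ← intervalIntegral.integral_sub (hiG t) (hiF (t + 1))]
    have hc := continuous_cfc_inv_add_sq_mulVec (φ := fun t => t ^ 2) (hV (t + 1)).isHermitian
      (fun i => pow_pos ((hV (t + 1)).eigenvalues_pos i) 2) v
    refine intervalIntegral.integral_mono_on hΓ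
      (Continuous.intervalIntegrable (by fun_prop) _ _) ((hiG t).sub (hiF (t + 1)))
      fun r hr => ?_
    rw [← mul_sub]
    exact mul_le_mul_of_nonneg_left
      (resolvent_mul_sub_mul_resolvent_le (hV (t + 1)) (hV t) hβ r v) (hα.trans hr.1)
  have h2 : ∀ t, G t - F t ≤ (1 / 2) * Real.log (1 / β) * (v ⬝ᵥ v) := fun t => by
    rw [hF, hG, ← intervalIntegral.integral_sub (hiG t) (hiF t)]
    simp_rw [← mul_sub]
    have hpos : ∀ i, 0 < (hV t).isHermitian.eigenvalues i ^ 2 := fun i =>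
      pow_pos ((hV t).eigenvalues_pos i) 2
    refine integral_resolvent_sub_le (φ := fun t => β * t ^ 2) (hV t).isHermitian
      (fun i => mul_pos hβ (hpos i)) (fun i => ?_) (fun i => ?_) v α Γ
    · exact mul_le_of_le_one_left (hpos i).le hβ1
    · rw [div_mul_cancel_right₀ (hpos i).ne', one_div]
  have h3 : F 0 - F T ≤ (1 / 2) * L * (v ⬝ᵥ v) := by
    -- As `V 0 ^ 2` is scalar, its resolvent is also a constant function of `V T`, so the two
    -- endpoints can be compared in one eigenbasis.
    have e0 : ∀ r : ℝ, cfc (fun t => (t ^ 2 + r ^ 2)⁻¹) (V 0) =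
        cfc (fun _ => (ε + r ^ 2)⁻¹) (V T) := fun r => by
      rw [cfc_const _ _ (hV T).isHermitian.isSelfAdjoint,
        ← cfc_const _ _ (hV 0).isHermitian.isSelfAdjoint]
      refine cfc_congr_eigenvalues (hV 0).isHermitian fun i => ?_
      have hH := (hV 0).isHermitian
      have h4 : hH.eigenvalues i ^ 2 = ε := by
        rw [← eigenvectorBasis_dotProduct_sq_mulVec hH, h0, smul_mulVec, one_mulVec,
          dotProduct_smul, eigenvectorBasis_dotProduct_self, smul_eq_mul, mul_one]
      rw [h4]
    simp_rw [hF]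
    rw [← intervalIntegral.integral_sub (hiF 0) (hiF T)]
    simp_rw [← mul_sub, e0]
    exact integral_resolvent_sub_le (φ := fun _ => ε) (hV T).isHermitian (fun _ => hε) hlow hL v α Γ
  calc _ ≤ ∑ t ∈ Finset.range T, ((F t - F (t + 1)) +
        (1 / 2) * Real.log (1 / β) * (v ⬝ᵥ v)) :=
        Finset.sum_le_sum fun t _ => by linarith [h1 t, h2 t]
    _ = F 0 - F T + T * ((1 / 2) * Real.log (1 / β) * (v ⬝ᵥ v)) := by
        rw [Finset.sum_add_distrib, Finset.sum_range_sub', Finset.sum_const, Finset.card_range,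
          nsmul_eq_mul]
    _ ≤ _ := by linarith

theorem sum_dotProduct_inv_conj_le {V : ℕ → Matrix n n ℝ} (hV : ∀ t, (V t).PosDef) {ε β L ρ : ℝ}
    (hε : 0 < ε) (hβ : 0 < β) (hβ1 : β ≤ 1) (h0 : V 0 ^ 2 = ε • (1 : Matrix n n ℝ)) (T : ℕ)
    (hX : ∀ t, (V (t + 1) ^ 2 - β • V t ^ 2).PosSemidef)
    (hlow : ∀ t i, ε ≤ (hV t).isHermitian.eigenvalues i ^ 2)
    (hL : ∀ i, Real.log ((hV T).isHermitian.eigenvalues i ^ 2 / ε) ≤ L) (hρ : 0 ≤ ρ)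
    (htr : ∑ t ∈ Finset.range T, trace (V (t + 1) ^ 2 - β • V t ^ 2) ≤ ε * ρ) (v : n → ℝ) :
    ∑ t ∈ Finset.range T, v ⬝ᵥ (cfc (fun x : ℝ => x⁻¹) (V (t + 1)) *
        (V (t + 1) ^ 2 - β • V t ^ 2) * cfc (fun x : ℝ => x⁻¹) (V (t + 1))) *ᵥ v ≤
      ((1 + Real.log (1 + ρ)) * (T * Real.log (1 / β) + L) + 8) * (v ⬝ᵥ v) := by
  have hvv : 0 ≤ v ⬝ᵥ v := by simpa using dotProduct_star_self_nonneg v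
  -- The ratio of the truncation limits will be `k² = R`. Then `log R = 1 + log(1 + ρ)`, while `R >
  -- ρ` keeps the total truncation error at most `8`.
  set R := Real.exp 1 * (1 + ρ) with hR
  have hR1 : 1 + ρ < R := by
    have := Real.add_one_lt_exp (one_ne_zero (α := ℝ))
    nlinarith
  have hR0 : 0 < R := by linarith
  have hlogR : Real.log R = 1 + Real.log (1 + ρ) := by
    rw [hR, Real.log_mul (Real.exp_pos 1).ne' (by linarith), Real.log_exp]
  set s := √ε with hs
  set k := √R with hk
  have hs2 : s ^ 2 = ε := Real.sq_sqrt hε.le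
  have hk2 : k ^ 2 = R := Real.sq_sqrt hR0.le
  have hs0 : 0 < s := Real.sqrt_pos.2 hε
  have hk1 : 1 < k := by
    rw [hk, Real.lt_sqrt zero_le_one]; linarith
  have hk0 : 0 < k := by linarith
  have hαΓ : s / k ≤ s * k := by
    rw [div_le_iff₀ hk0]
    nlinarith [mul_lt_mul_of_pos_left hk1 hs0, mul_pos hs0 hk0]
  have h1 := fun t => dotProduct_inv_conj_le (hV (t + 1)) (hX t) hs0 hk1
    (by rw [hs2]; exact hlow (t + 1)) v
  have h2 := sum_integral_resolvent_le hV hε hβ hβ1 h0 T (hlow T) hL v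
    (div_pos hs0 hk0).le hαΓ
  refine (Finset.sum_le_sum fun t _ => h1 t).trans ?_
  rw [Finset.sum_add_distrib, ← Finset.mul_sum, ← Finset.sum_mul, ← Finset.mul_sum, hs2, hk2,
    hlogR]
  have hl0 : 0 ≤ 1 + Real.log (1 + ρ) := by
    have := Real.log_nonneg (show 1 ≤ 1 + ρ by linarith)
    linarith
  have h3 : 8 / (ε * R) * ∑ t ∈ Finset.range T, trace (V (t + 1) ^ 2 - β • V t ^ 2) ≤ 8 := by
    refine (mul_le_mul_of_nonneg_left htr (by positivity)).trans ?_
    rw [div_mul_eq_mul_div, div_le_iff₀ (by positivity)]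
    nlinarith
  have h4 := mul_le_mul_of_nonneg_left h2 hl0
  have h5 := mul_le_mul_of_nonneg_right h3 hvv
  -- The factor `1/2` in the telescoped bound is discarded, so that bound must be nonnegative; it
  -- dominates integrals of nonnegative forms.
  have h6 : 0 ≤ (1 + Real.log (1 + ρ)) * ((1 / 2) * (T * Real.log (1 / β) + L) * (v ⬝ᵥ v)) :=
    le_trans (mul_nonneg hl0 (Finset.sum_nonneg fun t _ =>
      intervalIntegral.integral_nonneg hαΓ fun r hr =>
      mul_nonneg ((div_pos hs0 hk0).le.trans hr.1) ((hX t).dotProduct_mulVec_self_nonneg _))) h4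
  linarith

theorem commute_cfc {V W : Matrix n n ℝ} (hV : V.IsHermitian) (h : Commute W V) (f : ℝ → ℝ) :
    Commute W (cfc f V) := by
  have h1 : cfc f V ∈ Subalgebra.centralizer ℝ {W} := by
    refine cfc_mem_subalgebra _ hV ?_ f
    rw [Subalgebra.mem_centralizer_iff]
    rintro _ rfl
    exact h.eq
  rw [Subalgebra.mem_centralizer_iff] at h1
  exact h1 W rfl

-- Telescoping is applied to `V (t + 1) ^ 2 - V t ^ 2`, that is with decay `1`, so no `log(1/β)`
-- arises. The decay enters only through `V⁻¹XV⁻¹ = (1 - β)I + βV⁻¹DV⁻¹`.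
open Filter Topology in
theorem sum_dotProduct_inv_conj_le_of_commute {V : ℕ → Matrix n n ℝ} (hV : ∀ t, (V t).PosDef)
    {ε β L : ℝ} (hε : 0 < ε) (hβ : 0 < β) (h0 : V 0 ^ 2 = ε • (1 : Matrix n n ℝ)) (T : ℕ)
    (hcomm : ∀ t, Commute (V t) (V (t + 1)))
    (hlow : ∀ i, ε ≤ (hV T).isHermitian.eigenvalues i ^ 2)
    (hL : ∀ i, Real.log ((hV T).isHermitian.eigenvalues i ^ 2 / ε) ≤ L) (v : n → ℝ) :
    ∑ t ∈ Finset.range T, v ⬝ᵥ (cfc (fun x : ℝ => x⁻¹) (V (t + 1)) *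
        (V (t + 1) ^ 2 - β • V t ^ 2) * cfc (fun x : ℝ => x⁻¹) (V (t + 1))) *ᵥ v ≤
      ((1 - β) * T + β * L) * (v ⬝ᵥ v) := by
  set D : ℕ → Matrix n n ℝ := fun t => V (t + 1) ^ 2 - (1 : ℝ) • V t ^ 2 with hD
  have hDc : ∀ t f, Commute (D t) (cfc f (V (t + 1))) := fun t f => by
    refine commute_cfc (hV (t + 1)).isHermitian ?_ f
    exact ((Commute.refl _).pow_left 2).sub_left (((hcomm t).pow_left 2).smul_left _)
  have hconj : ∀ t f, v ⬝ᵥ (cfc f (V (t + 1)) * D t * cfc f (V (t + 1))) *ᵥ v =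
      v ⬝ᵥ D t *ᵥ (cfc (fun x => f x * f x) (V (t + 1)) *ᵥ v) := fun t f => by
    rw [← (hDc t f).eq, mul_assoc, cfc_mul_cfc, mulVec_mulVec]
  have hpos : ∀ t i, 0 < (hV t).isHermitian.eigenvalues i ^ 2 := fun t i =>
    pow_pos ((hV t).eigenvalues_pos i) 2
  have hint : ∀ t Γ, ∫ r in (0 : ℝ)..Γ, r *
        (cfc (fun t => (t ^ 2 + r ^ 2)⁻¹) (V (t + 1)) *ᵥ v ⬝ᵥ (V (t + 1) ^ 2 - (1 : ℝ) • V t ^ 2) *ᵥ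
          (cfc (fun t => (t ^ 2 + r ^ 2)⁻¹) (V (t + 1)) *ᵥ v)) =
      (1 / 2) * (v ⬝ᵥ D t *ᵥ
        (cfc (fun x : ℝ => (x ^ 2)⁻¹ - (x ^ 2 + Γ ^ 2)⁻¹) (V (t + 1)) *ᵥ v)) := fun t Γ => by
    have hDH : (D t).IsHermitian :=
      ((hV (t + 1)).isHermitian.pow 2).sub (((hV t).isHermitian.pow 2).smul (IsSelfAdjoint.all _))
    have e : ∀ r : ℝ, r * (cfc (fun t => (t ^ 2 + r ^ 2)⁻¹) (V (t + 1)) *ᵥ v ⬝ᵥ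
          D t *ᵥ (cfc (fun t => (t ^ 2 + r ^ 2)⁻¹) (V (t + 1)) *ᵥ v)) =
        ∑ i, (1 / 2) * (2 * r * (((hV (t + 1)).isHermitian.eigenvalues i ^ 2 + r ^ 2)⁻¹ *
          ((hV (t + 1)).isHermitian.eigenvalues i ^ 2 + r ^ 2)⁻¹)) *
          ((D t *ᵥ v ⬝ᵥ (hV (t + 1)).isHermitian.eigenvectorBasis i) *
            ((hV (t + 1)).isHermitian.eigenvectorBasis i ⬝ᵥ v)) := fun r => by
      rw [(isHermitian_cfc _ _).mulVec_dotProduct, mulVec_mulVec, mulVec_mulVec,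
        hconj, ← hDH.mulVec_dotProduct, dotProduct_cfc_mulVec (hV (t + 1)).isHermitian,
        Finset.mul_sum]
      exact Finset.sum_congr rfl fun i _ => by ring
    change ∫ r in (0 : ℝ)..Γ, r * (cfc (fun t => (t ^ 2 + r ^ 2)⁻¹) (V (t + 1)) *ᵥ v ⬝ᵥ
          D t *ᵥ (cfc (fun t => (t ^ 2 + r ^ 2)⁻¹) (V (t + 1)) *ᵥ v)) = _
    simp_rw [e]
    rw [intervalIntegral.integral_finsetSum, ← hDH.mulVec_dotProduct,
      dotProduct_cfc_mulVec (hV (t + 1)).isHermitian, Finset.mul_sum]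
    · refine Finset.sum_congr rfl fun i _ => ?_
      rw [intervalIntegral.integral_mul_const, intervalIntegral.integral_const_mul,
        integral_mul_inv_add_sq_sq (hpos _ i)]
      ring
    · intro i _
      have := continuous_inv_add_sq (hpos (t + 1) i)
      exact Continuous.intervalIntegrable (by fun_prop) _ _
  have hbound : ∀ Γ : ℝ, 0 ≤ Γ → ∑ t ∈ Finset.range T, v ⬝ᵥ D t *ᵥ
        (cfc (fun x : ℝ => (x ^ 2)⁻¹ - (x ^ 2 + Γ ^ 2)⁻¹) (V (t + 1)) *ᵥ v) ≤ L * (v ⬝ᵥ v) := by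
    intro Γ hΓ
    have h := sum_integral_resolvent_le hV hε one_pos le_rfl h0 T hlow hL v le_rfl hΓ
    simp_rw [hint] at h
    rw [← Finset.mul_sum, div_one, Real.log_one] at h
    linarith
  have hlim : Tendsto (fun Γ : ℝ => ∑ t ∈ Finset.range T, v ⬝ᵥ D t *ᵥ
        (cfc (fun x : ℝ => (x ^ 2)⁻¹ - (x ^ 2 + Γ ^ 2)⁻¹) (V (t + 1)) *ᵥ v)) atTop
      (𝓝 (∑ t ∈ Finset.range T, v ⬝ᵥ D t *ᵥ
        (cfc (fun x : ℝ => (x ^ 2)⁻¹) (V (t + 1)) *ᵥ v))) := by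
    refine tendsto_finsetSum _ fun t _ => ?_
    simp_rw [dotProduct_mulVec v (D t), dotProduct_cfc_mulVec (hV (t + 1)).isHermitian]
    refine tendsto_finsetSum _ fun i _ => Tendsto.mul_const _ ?_
    have h1 : Tendsto (fun Γ : ℝ => ((hV (t + 1)).isHermitian.eigenvalues i ^ 2 + Γ ^ 2)⁻¹) atTop
        (𝓝 0) :=
      tendsto_inv_atTop_zero.comp (tendsto_atTop_add_const_left _ _ (tendsto_pow_atTop two_ne_zero))
    simpa using tendsto_const_nhds.sub h1
  -- The bound is uniform in `Γ`, and `Γ → ∞` turns the truncated integral into `V⁻²`.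
  have hfin := le_of_tendsto hlim ((eventually_ge_atTop 0).mono hbound)
  have hterm : ∀ t, v ⬝ᵥ (cfc (fun x : ℝ => x⁻¹) (V (t + 1)) *
        (V (t + 1) ^ 2 - β • V t ^ 2) * cfc (fun x : ℝ => x⁻¹) (V (t + 1))) *ᵥ v =
      (1 - β) * (v ⬝ᵥ v) +
        β * (v ⬝ᵥ D t *ᵥ (cfc (fun x : ℝ => (x ^ 2)⁻¹) (V (t + 1)) *ᵥ v)) := fun t => by
    have e1 : V (t + 1) ^ 2 - β • V t ^ 2 = (1 - β) • V (t + 1) ^ 2 + β • D t := by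
      rw [hD]
      module
    have hH := (hV (t + 1)).isHermitian
    have e2 : cfc (fun x : ℝ => x⁻¹) (V (t + 1)) * V (t + 1) ^ 2 *
        cfc (fun x : ℝ => x⁻¹) (V (t + 1)) = 1 := by
      rw [← cfc_pow_id (R := ℝ) (V (t + 1)) 2 hH.isSelfAdjoint, cfc_mul_cfc, cfc_mul_cfc]
      refine cfc_eq_one hH fun i => ?_
      have := ((hV (t + 1)).eigenvalues_pos i).ne'
      field_simp
    have e3 := hconj t (fun x => x⁻¹)
    have e4 : (fun x : ℝ => x⁻¹ * x⁻¹) = fun x => (x ^ 2)⁻¹ := by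
      funext x; rw [sq, mul_inv]
    rw [e4] at e3
    rw [e1, mul_add, add_mul, mul_smul_comm, mul_smul_comm, smul_mul_assoc, smul_mul_assoc, e2,
      add_mulVec, dotProduct_add, smul_mulVec, smul_mulVec, one_mulVec, dotProduct_smul,
      dotProduct_smul, e3, smul_eq_mul, smul_eq_mul]
  simp_rw [hterm]
  rw [Finset.sum_add_distrib, Finset.sum_const, Finset.card_range, ← Finset.mul_sum, nsmul_eq_mul]
  have := mul_le_mul_of_nonneg_left hfin hβ.le
  linarith

end Matrix

/-! ### The sequence of preconditioners -/

section Sequence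

open Matrix

variable {d : ℕ} {K : Subalgebra ℝ (Matrix (Fin d) (Fin d) ℝ)} {ε β : ℝ}
  {g : ℕ → EuclideanSpace ℝ (Fin d)}

theorem weightedMoment_posSemidef (hβ : 0 ≤ β) (t : ℕ) : (weightedMoment β g t).PosSemidef := by
  induction t with
  | zero => exact PosSemidef.zero
  | succ t ih => exact (ih.smul hβ).add (posSemidef_vecMulVec_self _)

theorem weightedMoment_add_posSemidef (hε : 0 ≤ ε) (hβ : 0 ≤ β) (t : ℕ) :
    (weightedMoment β g t + ε • (1 : Matrix (Fin d) (Fin d) ℝ)).PosSemidef :=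
  (weightedMoment_posSemidef hβ t).add (PosSemidef.one.smul hε)

theorem precondSeq_spec (hε : 0 ≤ ε) (hβ : 0 ≤ β) (t : ℕ) :
    (precondSeq {A | A.PosSemidef ∧ A ∈ K} ε β g t).PosSemidef ∧
      precondSeq {A | A.PosSemidef ∧ A ∈ K} ε β g t ∈ K ∧
      ∀ B ∈ K, B.transpose ∈ K →
        trace (precondSeq {A | A.PosSemidef ∧ A ∈ K} ε β g t ^ 2 * B) =
          trace (weightedMoment β g t * B) + ε * trace B := by
  have h := precond_spec (K := K) (weightedMoment_add_posSemidef (g := g) hε hβ t)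
  refine ⟨h.1, h.2.1, fun B hB hB' => ?_⟩
  rw [precondSeq, h.2.2.1 B hB hB', add_mul, trace_add, smul_mul_assoc, one_mul, trace_smul,
    smul_eq_mul]

/-- The second-order increments are the projections of `g_t g_tᵀ + (1 - β) ε I`. -/
theorem trace_increment_mul (hε : 0 ≤ ε) (hβ : 0 ≤ β) (t : ℕ)
    {B : Matrix (Fin d) (Fin d) ℝ} (hB : B ∈ K) (hB' : B.transpose ∈ K) :
    trace ((precondSeq {A | A.PosSemidef ∧ A ∈ K} ε β g (t + 1) ^ 2 -
        β • precondSeq {A | A.PosSemidef ∧ A ∈ K} ε β g t ^ 2) * B) =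
      trace (vecMulVec (g t) (g t) * B) + (1 - β) * ε * trace B := by
  rw [sub_mul, trace_sub, smul_mul_assoc, trace_smul, smul_eq_mul,
    (precondSeq_spec hε hβ (t + 1)).2.2 B hB hB', (precondSeq_spec hε hβ t).2.2 B hB hB',
    weightedMoment, add_mul, trace_add, smul_mul_assoc, trace_smul, smul_eq_mul]
  ring

theorem increment_mem (hε : 0 ≤ ε) (hβ : 0 ≤ β) (t : ℕ) :
    precondSeq {A | A.PosSemidef ∧ A ∈ K} ε β g (t + 1) ^ 2 -
        β • precondSeq {A | A.PosSemidef ∧ A ∈ K} ε β g t ^ 2 ∈ K :=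
  K.sub_mem (K.pow_mem (precondSeq_spec hε hβ (t + 1)).2.1 2)
    (K.smul_mem (K.pow_mem (precondSeq_spec hε hβ t).2.1 2) β)

theorem increment_posSemidef (hε : 0 ≤ ε) (hβ : 0 ≤ β) (hβ1 : β ≤ 1) (t : ℕ) :
    (precondSeq {A | A.PosSemidef ∧ A ∈ K} ε β g (t + 1) ^ 2 -
        β • precondSeq {A | A.PosSemidef ∧ A ∈ K} ε β g t ^ 2).PosSemidef := by
  refine posSemidef_of_trace_mul_nonneg (K := K) ?_ (increment_mem hε hβ t) fun B hB hBp => ?_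
  · exact ((precondSeq_spec hε hβ (t + 1)).1.isHermitian.pow 2).sub
      (((precondSeq_spec hε hβ t).1.isHermitian.pow 2).smul (IsSelfAdjoint.all _))
  · rw [trace_increment_mul hε hβ t hB (by rw [hBp.isHermitian.transpose_eq]; exact hB)]
    exact add_nonneg ((posSemidef_vecMulVec_self _).trace_mul_nonneg hBp)
      (mul_nonneg (mul_nonneg (by linarith) hε) hBp.trace_nonneg)

/-- This difference is the projection of the weighted moment, whose pairings with positive
semidefinite members of `K` are nonnegative. -/
theorem sq_sub_smul_one_posSemidef (hε : 0 ≤ ε) (hβ : 0 ≤ β) (t : ℕ) :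
    (precondSeq {A | A.PosSemidef ∧ A ∈ K} ε β g t ^ 2 -
      ε • (1 : Matrix (Fin d) (Fin d) ℝ)).PosSemidef := by
  have h := precondSeq_spec (K := K) (g := g) hε hβ t
  refine posSemidef_of_trace_mul_nonneg (K := K) ?_
    (K.sub_mem (K.pow_mem h.2.1 2) (K.smul_mem K.one_mem ε)) fun B hB hBp => ?_
  · exact (h.1.isHermitian.pow 2).sub (isHermitian_one.smul (IsSelfAdjoint.all _))
  · rw [sub_mul, trace_sub, h.2.2 B hB (by rw [hBp.isHermitian.transpose_eq]; exact hB),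
      smul_mul_assoc, one_mul, trace_smul, smul_eq_mul, add_sub_cancel_right]
    exact (weightedMoment_posSemidef hβ t).trace_mul_nonneg hBp

theorem precondSeq_zero_sq (hε : 0 ≤ ε) (hβ : 0 ≤ β) :
    precondSeq {A | A.PosSemidef ∧ A ∈ K} ε β g 0 ^ 2 = ε • (1 : Matrix (Fin d) (Fin d) ℝ) := by
  have h := precondSeq_spec (K := K) (g := g) hε hβ 0
  refine eq_of_trace_mul_eq (K := K) (K.pow_mem h.2.1 2) ?_ (K.smul_mem K.one_mem ε) ?_
    fun B hB hB' => ?_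
  · rw [(h.1.isHermitian.pow 2).transpose_eq]; exact K.pow_mem h.2.1 2
  · rw [transpose_smul, transpose_one]; exact K.smul_mem K.one_mem ε
  · rw [h.2.2 B hB hB', weightedMoment, zero_mul, trace_zero, zero_add, smul_mul_assoc, one_mul,
      trace_smul, smul_eq_mul]

theorem le_eigenvalues_sq (hε : 0 ≤ ε) (hβ : 0 ≤ β) (t : ℕ)
    (hV : (precondSeq {A | A.PosSemidef ∧ A ∈ K} ε β g t).IsHermitian) (i : Fin d) :
    ε ≤ hV.eigenvalues i ^ 2 := by
  have h := (sq_sub_smul_one_posSemidef (K := K) (g := g) hε hβ t).dotProduct_mulVec_self_nonneg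
    (hV.eigenvectorBasis i)
  rw [sub_mulVec, dotProduct_sub, eigenvectorBasis_dotProduct_sq_mulVec, smul_mulVec, one_mulVec,
    dotProduct_smul, eigenvectorBasis_dotProduct_self, smul_eq_mul, mul_one] at h
  linarith

theorem precondSeq_posDef (hε : 0 < ε) (hβ : 0 ≤ β) (t : ℕ) :
    (precondSeq {A | A.PosSemidef ∧ A ∈ K} ε β g t).PosDef := by
  have h := (precondSeq_spec (K := K) (g := g) hε.le hβ t).1
  rw [h.isHermitian.posDef_iff_eigenvalues_pos]
  intro i
  refine lt_of_le_of_ne (h.eigenvalues_nonneg i) fun h0 => ?_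
  have h1 := le_eigenvalues_sq hε.le hβ t h.isHermitian i
  rw [← h0] at h1
  norm_num at h1
  linarith

theorem eigenvalues_sq_div_le_opNorm {V : Matrix (Fin d) (Fin d) ℝ} (hV : V.IsHermitian)
    (i : Fin d) : hV.eigenvalues i ^ 2 / ε ≤ opNorm ((1 / ε) • V ^ 2) := by
  have h := dotProduct_mulVec_le_opNorm ((1 / ε) • V ^ 2) (hV.eigenvectorBasis i)
  rw [smul_mulVec, dotProduct_smul, eigenvectorBasis_dotProduct_sq_mulVec,
    eigenvectorBasis_dotProduct_self, mul_one, smul_eq_mul] at h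
  exact le_of_eq_of_le (by ring) h

theorem log_opNorm_nonneg (hε : 0 < ε) (hβ : 0 ≤ β) (t : ℕ) :
    0 ≤ Real.log (opNorm ((1 / ε) • precondSeq {A | A.PosSemidef ∧ A ∈ K} ε β g t ^ 2)) := by
  rcases Nat.eq_zero_or_pos d with rfl | hd
  -- In dimension zero the norm is `0`, and the convention `Real.log 0 = 0` gives the claim.
  · have h : opNorm ((1 / ε) • precondSeq {A | A.PosSemidef ∧ A ∈ K} ε β g t ^ 2) = 0 := by
      rw [Subsingleton.elim ((1 / ε) • precondSeq {A | A.PosSemidef ∧ A ∈ K} ε β g t ^ 2) 0, opNorm,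
        map_zero, norm_zero]
    rw [h, Real.log_zero]
  · have hH := (precondSeq_posDef (K := K) (g := g) hε hβ t).isHermitian
    refine Real.log_nonneg (le_trans ?_ (eigenvalues_sq_div_le_opNorm hH ⟨0, hd⟩))
    rw [one_le_div hε]
    exact le_eigenvalues_sq hε.le hβ t hH _

theorem secondOrderSum_posSemidef (hε : 0 ≤ ε) (hβ : 0 ≤ β) (hβ1 : β ≤ 1) (T : ℕ) :
    (secondOrderSum {A | A.PosSemidef ∧ A ∈ K} ε β g T).PosSemidef :=
  posSemidef_sum _ fun t _ => PosSemidef.conj (isHermitian_cfc _ _)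
    (increment_posSemidef hε hβ hβ1 t)

theorem dotProduct_secondOrderSum_mulVec (𝓗 : Set (Matrix (Fin d) (Fin d) ℝ)) (T : ℕ)
    (v : Fin d → ℝ) : v ⬝ᵥ secondOrderSum 𝓗 ε β g T *ᵥ v =
      ∑ t ∈ Finset.range T, v ⬝ᵥ (cfc (fun x : ℝ => x⁻¹) (precondSeq 𝓗 ε β g (t + 1)) *
        (precondSeq 𝓗 ε β g (t + 1) ^ 2 - β • precondSeq 𝓗 ε β g t ^ 2) *
        cfc (fun x : ℝ => x⁻¹) (precondSeq 𝓗 ε β g (t + 1))) *ᵥ v := by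
  rw [secondOrderSum, sum_mulVec, dotProduct_sum]
  rfl

/-- `UHU` is a symmetric member of `K`, so pairing it with the increment gives the squared norm plus
a nonnegative `(1 - β)ε` term. Only `U ∈ K` and its symmetry matter, so the pseudo-inverse of a
singular preconditioner is covered. -/
theorem sum_matNorm_sq_le (hε : 0 ≤ ε) (hβ : 0 ≤ β) (hβ1 : β ≤ 1) (T : ℕ)
    {H : Matrix (Fin d) (Fin d) ℝ} (hH : H.PosSemidef) (hK : H ∈ K) :
    ∑ t ∈ Finset.range T,
        matNorm H
          ((symInv (precondSeq {A | A.PosSemidef ∧ A ∈ K} ε β g (t + 1))).mulVec (g t)) ^ 2 ≤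
      trace H * opNorm (secondOrderSum {A | A.PosSemidef ∧ A ∈ K} ε β g T) := by
  refine le_trans ?_ (trace_mul_le_opNorm
    (secondOrderSum_posSemidef (K := K) (g := g) hε hβ hβ1 T).isHermitian hH)
  rw [secondOrderSum, Finset.sum_mul, trace_sum]
  refine Finset.sum_le_sum fun t _ => ?_
  have hV := precondSeq_spec (K := K) (g := g) hε hβ (t + 1)
  set U := symInv (precondSeq {A | A.PosSemidef ∧ A ∈ K} ε β g (t + 1)) with hU
  have hUH : U.IsHermitian := isHermitian_cfc _ _
  have hUK : U ∈ K := cfc_mem_subalgebra K hV.1.isHermitian hV.2.1 _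
  have hB : (U * H * U).PosSemidef := PosSemidef.conj hUH hH
  have hBK : U * H * U ∈ K := K.mul_mem (K.mul_mem hUK hK) hUK
  have h := trace_increment_mul (K := K) (g := g) hε hβ t hBK
    (by rw [hB.isHermitian.transpose_eq]; exact hBK)
  have h1 : matNorm H (U *ᵥ g t) ^ 2 = trace (vecMulVec (g t) (g t) * (U * H * U)) := by
    rw [matNorm, Real.sq_sqrt (hH.dotProduct_mulVec_self_nonneg _),
      ← dotProduct_mulVec_self_eq_trace, ← mulVec_mulVec, ← mulVec_mulVec, hUH.mulVec_dotProduct]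
  have h2 : ∀ X : Matrix (Fin d) (Fin d) ℝ, trace (U * X * U * H) = trace (X * (U * H * U)) := by
    intro X
    rw [mul_assoc, mul_assoc, trace_mul_comm]
    simp only [mul_assoc]
  rw [h1, h2, h]
  exact le_add_of_nonneg_right (mul_nonneg (mul_nonneg (by linarith) hε) hB.trace_nonneg)

theorem sum_trace_increment (hε : 0 ≤ ε) (hβ : 0 ≤ β) (T : ℕ) :
    ∑ t ∈ Finset.range T, trace (precondSeq {A | A.PosSemidef ∧ A ∈ K} ε β g (t + 1) ^ 2 -
        β • precondSeq {A | A.PosSemidef ∧ A ∈ K} ε β g t ^ 2) =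
      ∑ t ∈ Finset.range T, ‖g t‖ ^ 2 + T * ((1 - β) * ε * d) := by
  have h : ∀ t, trace (precondSeq {A | A.PosSemidef ∧ A ∈ K} ε β g (t + 1) ^ 2 -
        β • precondSeq {A | A.PosSemidef ∧ A ∈ K} ε β g t ^ 2) =
      ‖g t‖ ^ 2 + (1 - β) * ε * d := fun t => by
    have h1 := trace_increment_mul (K := K) (g := g) hε hβ t K.one_mem
      (by rw [transpose_one]; exact K.one_mem)
    rw [mul_one, mul_one, trace_vecMulVec, trace_one, Fintype.card_fin] at h1
    rw [h1, EuclideanSpace.real_norm_sq_eq]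
    simp [dotProduct, sq]
  simp_rw [h]
  rw [Finset.sum_add_distrib, Finset.sum_const, Finset.card_range, nsmul_eq_mul]

theorem opNorm_secondOrderSum_le (hε : 0 < ε) (hβ : 0 < β) (hβ1 : β ≤ 1) (T : ℕ) :
    opNorm (secondOrderSum {A | A.PosSemidef ∧ A ∈ K} ε β g T) ≤
      (1 + Real.log (1 + (d : ℝ) / ε * ∑ t ∈ Finset.range T, ‖g t‖ ^ 2 +
          (d : ℝ) ^ 2 * (1 - β) * (T : ℝ))) *
        ((1 - β) / β * (T : ℝ) +
          Real.log (opNorm ((1 / ε) • precondSeq {A | A.PosSemidef ∧ A ∈ K} ε β g T ^ 2))) + 8 := by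
  set L := Real.log (opNorm ((1 / ε) • precondSeq {A | A.PosSemidef ∧ A ∈ K} ε β g T ^ 2)) with hL
  have hL0 : 0 ≤ L := log_opNorm_nonneg hε hβ.le T
  have hG0 : 0 ≤ ∑ t ∈ Finset.range T, ‖g t‖ ^ 2 := Finset.sum_nonneg fun t _ => by positivity
  set G := ∑ t ∈ Finset.range T, ‖g t‖ ^ 2 with hG
  have hβ0 : 0 ≤ 1 - β := by linarith
  have hA : 0 ≤ (d : ℝ) / ε * G + (d : ℝ) ^ 2 * (1 - β) * T := by positivity
  have hB : 0 ≤ (1 - β) / β * (T : ℝ) := by positivity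
  have hlog0 : 0 ≤ 1 + Real.log (1 + (d : ℝ) / ε * G + (d : ℝ) ^ 2 * (1 - β) * T) := by
    have := Real.log_nonneg (show 1 ≤ 1 + (d : ℝ) / ε * G + (d : ℝ) ^ 2 * (1 - β) * T by linarith)
    linarith
  have hS := secondOrderSum_posSemidef (K := K) (g := g) hε.le hβ.le hβ1 T
  refine opNorm_le_of_dotProduct_mulVec_le hS
    (add_nonneg (mul_nonneg hlog0 (add_nonneg hB hL0)) (by norm_num)) fun v => ?_
  have hvv : 0 ≤ v ⬝ᵥ v := by simpa using dotProduct_star_self_nonneg v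
  rcases Nat.eq_zero_or_pos d with rfl | hd
  · simp [dotProduct]
  have hd1 : (1 : ℝ) ≤ d := by exact_mod_cast hd
  have hV := fun t => precondSeq_posDef (K := K) (g := g) hε hβ.le t
  -- This is the total trace of the increments divided by `ε`; the logarithm's argument in the claim
  -- is weaker by a factor `d ≥ 1` in both terms.
  set ρ := G / ε + d * (1 - β) * T with hρ
  have hρ0 : 0 ≤ ρ := by positivity
  have h := sum_dotProduct_inv_conj_le hV (L := L) (ρ := ρ) hε hβ hβ1
    (precondSeq_zero_sq hε.le hβ.le) T (increment_posSemidef hε.le hβ.le hβ1)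
    (fun t i => le_eigenvalues_sq hε.le hβ.le t _ i)
    (fun i => Real.log_le_log (div_pos (pow_pos ((hV T).eigenvalues_pos i) 2) hε)
      (eigenvalues_sq_div_le_opNorm _ i)) hρ0
    (by
      rw [sum_trace_increment hε.le hβ.le, hρ, ← hG]
      refine le_of_eq ?_
      field_simp) v
  rw [dotProduct_secondOrderSum_mulVec]
  refine h.trans (mul_le_mul_of_nonneg_right ?_ hvv)
  have h1 : Real.log (1 + ρ) ≤ Real.log (1 + (d : ℝ) / ε * G + (d : ℝ) ^ 2 * (1 - β) * T) := by
    refine Real.log_le_log (by linarith) ?_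
    have e1 : G / ε ≤ d * (G / ε) := le_mul_of_one_le_left (by positivity) hd1
    have e2 : d * (1 - β) * T ≤ d * (d * (1 - β) * T) :=
      le_mul_of_one_le_left (by positivity) hd1
    have e3 : (d : ℝ) / ε * G = d * (G / ε) := by ring
    rw [e3, hρ]
    linarith
  have h2 : Real.log (1 / β) ≤ (1 - β) / β := by
    refine (Real.log_le_sub_one_of_pos (by positivity)).trans_eq ?_
    field_simp
  have h3 : T * Real.log (1 / β) ≤ (1 - β) / β * T := by
    rw [mul_comm]; exact mul_le_mul_of_nonneg_right h2 (Nat.cast_nonneg T)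
  have h4 : 0 ≤ Real.log (1 / β) := Real.log_nonneg ((one_le_div hβ).2 hβ1)
  gcongr

theorem opNorm_secondOrderSum_le_of_commute (hε : 0 < ε) (hβ : 0 < β) (hβ1 : β ≤ 1) (T : ℕ)
    (hcomm : IsCommutativeSet {A | A.PosSemidef ∧ A ∈ K}) :
    opNorm (secondOrderSum {A | A.PosSemidef ∧ A ∈ K} ε β g T) ≤
      (1 - β) * (T : ℝ) +
        Real.log (opNorm ((1 / ε) • precondSeq {A | A.PosSemidef ∧ A ∈ K} ε β g T ^ 2)) := by
  set L := Real.log (opNorm ((1 / ε) • precondSeq {A | A.PosSemidef ∧ A ∈ K} ε β g T ^ 2)) with hL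
  have hL0 : 0 ≤ L := log_opNorm_nonneg hε hβ.le T
  have hβ0 : 0 ≤ 1 - β := by linarith
  have hS := secondOrderSum_posSemidef (K := K) (g := g) hε.le hβ.le hβ1 T
  refine opNorm_le_of_dotProduct_mulVec_le hS (by positivity) fun v => ?_
  have hvv : 0 ≤ v ⬝ᵥ v := by simpa using dotProduct_star_self_nonneg v
  have hV := fun t => precondSeq_posDef (K := K) (g := g) hε hβ.le t
  have hmem := fun t => precondSeq_spec (K := K) (g := g) hε.le hβ.le t
  rw [dotProduct_secondOrderSum_mulVec]
  refine (sum_dotProduct_inv_conj_le_of_commute hV (L := L) hε hβ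
    (precondSeq_zero_sq hε.le hβ.le) T
    (fun t => hcomm _ ⟨(hmem t).1, (hmem t).2.1⟩ _ ⟨(hmem (t + 1)).1, (hmem (t + 1)).2.1⟩)
    (fun i => le_eigenvalues_sq hε.le hβ.le T _ i)
    (fun i => Real.log_le_log (div_pos (pow_pos ((hV T).eigenvalues_pos i) 2) hε)
      (eigenvalues_sq_div_le_opNorm _ i)) v).trans (mul_le_mul_of_nonneg_right ?_ hvv)
  -- The abstract bound has `β * L`; nonnegativity of `L` allows dropping `β`.
  have := mul_le_of_le_one_left hL0 hβ1
  linarith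

end Sequence

theorem mainTheorem9 :
    ∃ C₁ C₂ : ℝ, 0 < C₁ ∧ 0 < C₂ ∧
      ∀ (d : ℕ) (𝓗 : Set (Matrix (Fin d) (Fin d) ℝ)), IsWellStructured 𝓗 →
      ∀ (ε β : ℝ), 0 ≤ ε → 0 < β → β ≤ 1 →
      ∀ (T : ℕ) (g : ℕ → EuclideanSpace ℝ (Fin d)),
        -- the preconditioners `V_{-1}, …, V_{T-1}` are well defined: each is the unique minimizer
        (∀ t ≤ T, ∀ V : Matrix (Fin d) (Fin d) ℝ,
          IsPrecond 𝓗 (weightedMoment β g t + ε • (1 : Matrix (Fin d) (Fin d) ℝ)) V ↔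
            V = precondSeq 𝓗 ε β g t) ∧
        -- the bound on the sum of second-order terms
        (∀ H ∈ 𝓗, H.PosDef →
          ∑ t ∈ Finset.range T,
              matNorm H ((symInv (precondSeq 𝓗 ε β g (t + 1))).mulVec (g t)) ^ 2 ≤
            Matrix.trace H * opNorm (secondOrderSum 𝓗 ε β g T)) ∧
        -- the bound on `S_T` for a general well-structured set
        (0 < ε →
          opNorm (secondOrderSum 𝓗 ε β g T) ≤
            C₁ * (1 + Real.log (1 + (d : ℝ) / ε * ∑ t ∈ Finset.range T, ‖g t‖ ^ 2 +
                (d : ℝ) ^ 2 * (1 - β) * (T : ℝ))) *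
              ((1 - β) / β * (T : ℝ) +
                Real.log (opNorm ((1 / ε) • precondSeq 𝓗 ε β g T ^ 2))) + C₂) ∧
        -- the improved bound on `S_T` for a commutative well-structured set
        (0 < ε → IsCommutativeSet 𝓗 →
          opNorm (secondOrderSum 𝓗 ε β g T) ≤
            (1 - β) * (T : ℝ) +
              Real.log (opNorm ((1 / ε) • precondSeq 𝓗 ε β g T ^ 2))) := by
  refine ⟨1, 8, one_pos, by norm_num, ?_⟩
  rintro d _ ⟨K, rfl⟩ ε β hε hβ hβ1 T g
  refine ⟨fun t _ V => (precond_spec (weightedMoment_add_posSemidef hε hβ.le t)).2.2.2 V,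
    fun H hH _ => sum_matNorm_sq_le hε hβ.le hβ1 T hH.1 hH.2, fun hε => ?_,
    fun hε hc => opNorm_secondOrderSum_le_of_commute hε hβ hβ1 T hc⟩
  rw [one_mul]
  exact opNorm_secondOrderSum_le hε hβ hβ1 T
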